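/- Let $(\mu_n)_{n\ge 1}$ be a sequence of Borel probability measures on $\mathbb{R}$, and let $\beta_n$ be finite positive Borel measures on $\mathbb{R}$ with $\beta_n\le\mu_n$ for all $n$. Assume that there is a constant $C>0$ such that, for every $n$, $|x-y|\le C$ for $(\beta_n\times\beta_n)$-a.e. $(x,y)\in\mathbb{R}^2$. If $$\sum_{n=1}^\infty \beta_n(\mathbb{R})\,\operatorname{Var}\bigl(\beta_n(\mathbb{R})^{-1}\beta_n\bigr)=+\infty,$$ where terms with $\beta_n=0$ are interpreted as $0$, then the tail boundary flow of $(\mu_n)_{n\ge1}$ is periodic. Here the tail boundary flow is defined as follows. Let $\mu_0$ be any probability measure on $\mathbb{R}$ equivalent to the Lebesgue measure, $(\Omega,\mu)=\prod_{k\ge1}(\mathbb{R},\mu_k)$ and $(\Omega_n,\tilde\mu_n)=\prod_{k\ge n+1}(\mathbb{R},\mu_k)$. Let $\pi_n:\mathbb{R}\times\Omega\to\mathbb{R}\times\Omega_n$ be the nonsingular map $\pi_n(t,\omega)=(t+\omega_1+\cdots+\omega_n,\ \omega_{n+1},\omega_{n+2},\ldots)$, let $A_n=\{G\circ\pi_n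 : G\in L^\infty(\mathbb{R}\times\Omega_n,\mu_0\times\tilde\mu_n)\}\subset L^\infty(\mathbb{R}\times\Omega,\mu_0\times\mu)$, and let $A=\bigcap_{n\ge0}A_n$ be the tail boundary. The tail boundary flow is the action of $\mathbb{R}$ on $A$ given by $(s\cdot F)(t,\omega)=F(t-s,\omega)$. It is called periodic if there is a $t\in\mathbb{R}\setminus\{0\}$ such that $t\cdot F=F$ for every $F\in A$. -/

import Mathlib

open MeasureTheory ProbabilityTheory
open scoped ENNReal

namespace TailBoundary

noncomputable section

/-! ### The `*`-algebra of measurable functions modulo null sets, and `L^∞` inside it -/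

section Algebra

variable {α : Type*} [MeasurableSpace α] {ν : Measure α}

instance instCommRingAEEq : CommRing (α →ₘ[ν] ℂ) :=
  { (inferInstance : AddCommGroup (α →ₘ[ν] ℂ)), (inferInstance : CommMonoid (α →ₘ[ν] ℂ)) with
    left_distrib := fun a b c => by
      induction a using AEEqFun.induction_on with | _ f hf
      induction b using AEEqFun.induction_on with | _ g hg
      induction c using AEEqFun.induction_on with | _ h hh
      simp only [AEEqFun.mk_add_mk, AEEqFun.mk_mul_mk, mul_add]
    right_distrib := fun a b c => by
      induction a using AEEqFun.induction_on with | _ f hf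
      induction b using AEEqFun.induction_on with | _ g hg
      induction c using AEEqFun.induction_on with | _ h hh
      simp only [AEEqFun.mk_add_mk, AEEqFun.mk_mul_mk, add_mul]
    zero_mul := fun a => by
      induction a using AEEqFun.induction_on with | _ f hf
      simp only [AEEqFun.zero_def, AEEqFun.mk_mul_mk]
      congr 1
      ext x
      simp
    mul_zero := fun a => by
      induction a using AEEqFun.induction_on with | _ f hf
      simp only [AEEqFun.zero_def, AEEqFun.mk_mul_mk]
      congr 1
      ext x
      simp }

instance instAlgebraAEEq : Algebra ℂ (α →ₘ[ν] ℂ) :=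
  Algebra.ofModule
    (fun c a b => by
      induction a using AEEqFun.induction_on with | _ f hf
      induction b using AEEqFun.induction_on with | _ g hg
      simp only [AEEqFun.smul_mk, AEEqFun.mk_mul_mk, smul_mul_assoc])
    (fun c a b => by
      induction a using AEEqFun.induction_on with | _ f hf
      induction b using AEEqFun.induction_on with | _ g hg
      simp only [AEEqFun.smul_mk, AEEqFun.mk_mul_mk, mul_smul_comm])

instance instStarRingAEEq : StarRing (α →ₘ[ν] ℂ) where
  star_mul := fun a b => by
    apply AEEqFun.ext
    filter_upwards [AEEqFun.coeFn_star (a * b), AEEqFun.coeFn_mul (star b) (star a),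
      AEEqFun.coeFn_star a, AEEqFun.coeFn_star b, AEEqFun.coeFn_mul a b] with x h1 h2 h3 h4 h5
    simp only [h1, h2, h3, h4, h5, Pi.star_apply, Pi.mul_apply, star_mul]
  star_add := fun a b => by
    apply AEEqFun.ext
    filter_upwards [AEEqFun.coeFn_star (a + b), AEEqFun.coeFn_add (star a) (star b),
      AEEqFun.coeFn_star a, AEEqFun.coeFn_star b, AEEqFun.coeFn_add a b] with x h1 h2 h3 h4 h5
    simp only [h1, h2, h3, h4, h5, Pi.star_apply, Pi.add_apply, star_add]

instance instStarModuleAEEq : StarModule ℂ (α →ₘ[ν] ℂ) where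
  star_smul := fun c a => by
    apply AEEqFun.ext
    filter_upwards [AEEqFun.coeFn_star (c • a), AEEqFun.coeFn_smul (star c) (star a),
      AEEqFun.coeFn_star a, AEEqFun.coeFn_smul c a] with x h1 h2 h3 h4
    simp only [h1, h2, h3, h4, Pi.star_apply, Pi.smul_apply, star_smul]

variable (ν) in
/-- The `*`-algebra `L^∞(α, ν)` of essentially bounded complex functions modulo null functions. -/
def Linfty : StarSubalgebra ℂ (α →ₘ[ν] ℂ) where
  carrier := {F | MemLp F ∞ ν}
  mul_mem' {a b} ha hb := by
    have h : MemLp (⇑a * ⇑b) ∞ ν := MemLp.mul' (p := ∞) (q := ∞) hb ha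
    exact h.ae_eq (AEEqFun.coeFn_mul a b).symm
  add_mem' {a b} ha hb := (MemLp.add ha hb).ae_eq (AEEqFun.coeFn_add a b).symm
  algebraMap_mem' c := by
    have h : MemLp (fun _ : α => c) ∞ ν := memLp_top_const c
    have e : (algebraMap ℂ (α →ₘ[ν] ℂ) c) = c • (1 : α →ₘ[ν] ℂ) := Algebra.algebraMap_eq_smul_one c
    refine h.ae_eq ?_
    rw [e]
    filter_upwards [AEEqFun.coeFn_smul c (1 : α →ₘ[ν] ℂ), AEEqFun.coeFn_one (α := α) (μ := ν) (β := ℂ)]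
      with x h1 h2
    simp [h1, h2]
  star_mem' {a} ha := (MemLp.star ha).ae_eq (AEEqFun.coeFn_star a).symm

variable {β : Type*} [MeasurableSpace β] {ν' : Measure β}

/-- The `*`-homomorphism `G ↦ G ∘ f` induced by a nonsingular map `f`. -/
def pullback (f : α → β) (hf : Measure.QuasiMeasurePreserving f ν ν') :
    (β →ₘ[ν'] ℂ) →⋆ₐ[ℂ] (α →ₘ[ν] ℂ) where
  toFun G := G.compQuasiMeasurePreserving f hf
  map_one' := rfl
  map_zero' := rfl
  map_mul' a b := by
    induction a using AEEqFun.induction_on with | _ f hf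
    induction b using AEEqFun.induction_on with | _ g hg
    rfl
  map_add' a b := by
    induction a using AEEqFun.induction_on with | _ f hf
    induction b using AEEqFun.induction_on with | _ g hg
    rfl
  commutes' c := by
    simp only [Algebra.algebraMap_eq_smul_one]
    rfl
  map_star' a := by
    induction a using AEEqFun.induction_on with | _ f hf
    rfl

theorem pullback_apply (f : α → β) (hf : Measure.QuasiMeasurePreserving f ν ν') (G : β →ₘ[ν'] ℂ) :
    pullback f hf G = G.compQuasiMeasurePreserving f hf := rfl

theorem pullback_coeFn (f : α → β) (hf : Measure.QuasiMeasurePreserving f ν ν') (G : β →ₘ[ν'] ℂ) :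
    pullback f hf G =ᵐ[ν] G ∘ f := AEEqFun.coeFn_compQuasiMeasurePreserving G hf

theorem pullback_mem_Linfty (f : α → β) (hf : Measure.QuasiMeasurePreserving f ν ν')
    {G : β →ₘ[ν'] ℂ} (hG : G ∈ Linfty ν') : pullback f hf G ∈ Linfty ν := by
  have hG' : MemLp G ∞ ν' := hG
  have h : MemLp (⇑G ∘ f) ∞ ν := by
    refine ⟨hG'.1.comp_quasiMeasurePreserving hf, ?_⟩
    have h2 := hG'.2
    simp only [eLpNorm_exponent_top] at h2 ⊢
    refine lt_of_le_of_lt ?_ h2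
    refine essSup_le_of_ae_le _ ?_
    exact hf.ae (ae_le_eLpNormEssSup (f := ⇑G) (μ := ν'))
  exact h.ae_eq (pullback_coeFn f hf G).symm

end Algebra

/-! ### The time-dependent random walk on `ℝ` -/

/-- `μ₀` is equivalent to (has the same null sets as) the Lebesgue measure. -/
class LebesgueEquivalent (μ₀ : Measure ℝ) : Prop where
  ac : μ₀ ≪ volume
  volume_ac : volume ≪ μ₀

/-- The product measure on the space `Ω_n` of steps after time `n`. The steps of the walk are
indexed by `0, 1, 2, …`, with laws `μ 0, μ 1, μ 2, …`. -/
def stepLaw (μ : ℕ → Measure ℝ) [∀ k, IsProbabilityMeasure (μ k)] (n : ℕ) : Measure (ℕ → ℝ) :=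
  Measure.infinitePi fun k => μ (k + n)

instance instProbStepLaw (μ : ℕ → Measure ℝ) [∀ k, IsProbabilityMeasure (μ k)] (n : ℕ) :
    IsProbabilityMeasure (stepLaw μ n) := by
  unfold stepLaw
  infer_instance

/-- The measure `μ₀ × (μ_{n+1} × μ_{n+2} × ⋯)` on `ℝ × Ω_n`. -/
def pathLaw (μ₀ : Measure ℝ) (μ : ℕ → Measure ℝ) [∀ k, IsProbabilityMeasure (μ k)] (n : ℕ) :
    Measure (ℝ × (ℕ → ℝ)) :=
  μ₀.prod (stepLaw μ n)

/-- `π_n (t, ω) = (t + ω_1 + ⋯ + ω_n, ω_{n+1}, ω_{n+2}, …)`. -/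
def tailMap (n : ℕ) (p : ℝ × (ℕ → ℝ)) : ℝ × (ℕ → ℝ) :=
  (p.1 + ∑ i ∈ Finset.range n, p.2 i, fun k => p.2 (k + n))

/-- `(t, ω) ↦ (t + s, ω)`. -/
def shift (s : ℝ) (p : ℝ × (ℕ → ℝ)) : ℝ × (ℕ → ℝ) := (p.1 + s, p.2)

theorem measurePreserving_steps (μ : ℕ → Measure ℝ) [∀ k, IsProbabilityMeasure (μ k)] (n : ℕ) :
    MeasurePreserving (fun (ω : ℕ → ℝ) k => ω (k + n)) (stepLaw μ 0) (stepLaw μ n) := by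
  have hm : Measurable (fun (ω : ℕ → ℝ) k => ω (k + n)) := by fun_prop
  refine ⟨hm, ?_⟩
  unfold stepLaw
  refine Measure.eq_infinitePi _ fun s t ht => ?_
  rw [Measure.map_apply hm (MeasurableSet.pi s.countable_toSet fun i _ => ht i)]
  have e : (fun (ω : ℕ → ℝ) k => ω (k + n)) ⁻¹' (Set.pi s t)
      = Set.pi (s.map (addRightEmbedding n) : Finset ℕ) (fun j => t (j - n)) := by
    ext ω
    simp [Set.mem_pi]
  rw [e, Measure.infinitePi_pi (μ := fun k => μ (k + 0)) (fun i _ => ht _)]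
  simp

theorem quasiMeasurePreserving_skew (μ₀ : Measure ℝ) [SFinite μ₀] [LebesgueEquivalent μ₀]
    {X Y : Type*} [MeasurableSpace X] [MeasurableSpace Y] {P : Measure X} {Q : Measure Y}
    [SFinite P] [SFinite Q] {σ : X → Y} (hσ : MeasurePreserving σ P Q) {g : X → ℝ}
    (hg : Measurable g) :
    Measure.QuasiMeasurePreserving (fun p : ℝ × X => (p.1 + g p.2, σ p.2))
      (μ₀.prod P) (μ₀.prod Q) := by
  have h1 : MeasurePreserving (fun q : X × ℝ => (σ q.1, q.2 + g q.1))
      (P.prod volume) (Q.prod volume) :=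
    hσ.skew_product (g := fun x t => t + g x) (by fun_prop)
      (Filter.Eventually.of_forall fun x => map_add_right_eq_self volume (g x))
  have h2 : MeasurePreserving (fun p : ℝ × X => (p.1 + g p.2, σ p.2))
      ((volume : Measure ℝ).prod P) ((volume : Measure ℝ).prod Q) :=
    Measure.measurePreserving_swap.comp (h1.comp Measure.measurePreserving_swap)
  exact h2.quasiMeasurePreserving.mono
    (LebesgueEquivalent.ac.prod Measure.AbsolutelyContinuous.rfl)
    (LebesgueEquivalent.volume_ac.prod Measure.AbsolutelyContinuous.rfl)

section Walk

variable (μ₀ : Measure ℝ) [IsProbabilityMeasure μ₀] [LebesgueEquivalent μ₀]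
  (μ : ℕ → Measure ℝ) [∀ k, IsProbabilityMeasure (μ k)]

theorem quasiMeasurePreserving_tailMap (n : ℕ) :
    Measure.QuasiMeasurePreserving (tailMap n) (pathLaw μ₀ μ 0) (pathLaw μ₀ μ n) :=
  quasiMeasurePreserving_skew μ₀ (measurePreserving_steps μ n)
    (g := fun ω => ∑ i ∈ Finset.range n, ω i) (by fun_prop)

theorem quasiMeasurePreserving_shift (n : ℕ) (s : ℝ) :
    Measure.QuasiMeasurePreserving (shift s) (pathLaw μ₀ μ n) (pathLaw μ₀ μ n) :=
  quasiMeasurePreserving_skew μ₀ (MeasurePreserving.id (stepLaw μ n)) (g := fun _ => s)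
    measurable_const

/-- The algebra `A_n = {G ∘ π_n | G ∈ L^∞(ℝ × Ω_n)}` of bounded functions on `ℝ × Ω` that only
depend on the walk from time `n` on. -/
def futureAlgebra (n : ℕ) : StarSubalgebra ℂ ((ℝ × (ℕ → ℝ)) →ₘ[pathLaw μ₀ μ 0] ℂ) :=
  (Linfty (pathLaw μ₀ μ n)).map (pullback (tailMap n) (quasiMeasurePreserving_tailMap μ₀ μ n))

/-- The tail boundary `A = ⋂ n, A_n`. -/
def tailBoundary : StarSubalgebra ℂ ((ℝ × (ℕ → ℝ)) →ₘ[pathLaw μ₀ μ 0] ℂ) :=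
  ⨅ n, futureAlgebra μ₀ μ n

/-- The action of `s ∈ ℝ` on functions on `ℝ × Ω` by translation in the first variable:
`(s · F)(t, ω) = F(t - s, ω)`. -/
def translate (s : ℝ) :
    ((ℝ × (ℕ → ℝ)) →ₘ[pathLaw μ₀ μ 0] ℂ) →⋆ₐ[ℂ] ((ℝ × (ℕ → ℝ)) →ₘ[pathLaw μ₀ μ 0] ℂ) :=
  pullback (shift (-s)) (quasiMeasurePreserving_shift μ₀ μ 0 (-s))

theorem translate_add (s t : ℝ) (F : (ℝ × (ℕ → ℝ)) →ₘ[pathLaw μ₀ μ 0] ℂ) :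
    translate μ₀ μ (s + t) F = translate μ₀ μ s (translate μ₀ μ t F) := by
  simp only [translate, pullback_apply]
  rw [← AEEqFun.compQuasiMeasurePreserving_comp]
  congr 1
  funext p
  simp only [shift, Function.comp, Prod.mk.injEq, and_true]
  ring

theorem translate_zero (F : (ℝ × (ℕ → ℝ)) →ₘ[pathLaw μ₀ μ 0] ℂ) :
    translate μ₀ μ 0 F = F := by
  apply AEEqFun.ext
  filter_upwards [pullback_coeFn _ (quasiMeasurePreserving_shift μ₀ μ 0 (-0)) F] with p hp
  rw [translate, hp]
  simp [shift]

theorem translate_mem (s : ℝ) {F : (ℝ × (ℕ → ℝ)) →ₘ[pathLaw μ₀ μ 0] ℂ}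
    (hF : F ∈ tailBoundary μ₀ μ) : translate μ₀ μ s F ∈ tailBoundary μ₀ μ := by
  rw [tailBoundary, StarSubalgebra.mem_iInf] at hF ⊢
  intro n
  obtain ⟨G, hG, rfl⟩ := hF n
  refine ⟨pullback _ (quasiMeasurePreserving_shift μ₀ μ n (-s)) G, pullback_mem_Linfty _ _ hG, ?_⟩
  change pullback _ (quasiMeasurePreserving_tailMap μ₀ μ n) (pullback _ _ G)
    = pullback _ (quasiMeasurePreserving_shift μ₀ μ 0 (-s))
      (pullback _ (quasiMeasurePreserving_tailMap μ₀ μ n) G)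
  simp only [pullback_apply]
  rw [← AEEqFun.compQuasiMeasurePreserving_comp, ← AEEqFun.compQuasiMeasurePreserving_comp]
  congr 1
  funext p
  simp only [shift, tailMap, Function.comp, Prod.mk.injEq, and_true]
  ring

/-- The translation by `s` restricted to the tail boundary. -/
def translateTail (s : ℝ) : tailBoundary μ₀ μ →⋆ₐ[ℂ] tailBoundary μ₀ μ :=
  ((translate μ₀ μ s).comp (tailBoundary μ₀ μ).subtype).codRestrict (tailBoundary μ₀ μ)
    fun F => translate_mem μ₀ μ s F.2

/-- The tail boundary flow: the action of `ℝ` by automorphisms of the tail boundary given by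
translation in the first variable. -/
def tailBoundaryFlow : Multiplicative ℝ →* (tailBoundary μ₀ μ ≃⋆ₐ[ℂ] tailBoundary μ₀ μ) :=
  MonoidHom.mk'
    (fun s => StarAlgEquiv.ofStarAlgHom (translateTail μ₀ μ s.toAdd) (translateTail μ₀ μ (-s.toAdd))
      (by
        ext F : 1
        apply Subtype.ext
        change translate μ₀ μ _ (translate μ₀ μ _ F.1) = F.1
        rw [← translate_add, neg_add_cancel, translate_zero])
      (by
        ext F : 1
        apply Subtype.ext
        change translate μ₀ μ _ (translate μ₀ μ _ F.1) = F.1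
        rw [← translate_add, add_neg_cancel, translate_zero]))
    (fun s t => by
      ext F : 1
      apply Subtype.ext
      exact translate_add μ₀ μ _ _ F.1)

theorem coe_tailBoundaryFlow (s : ℝ) (F : tailBoundary μ₀ μ) :
    (tailBoundaryFlow μ₀ μ (Multiplicative.ofAdd s) F : (ℝ × (ℕ → ℝ)) →ₘ[pathLaw μ₀ μ 0] ℂ)
      = translate μ₀ μ s F := rfl

end Walk

/-- A flow `ℝ ↷ A` is periodic if some `t ≠ 0` acts trivially on `A`. -/
def IsPeriodicFlow {A : Type*} [Ring A] [StarRing A] [Algebra ℂ A]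
    (φ : Multiplicative ℝ →* (A ≃⋆ₐ[ℂ] A)) : Prop :=
  ∃ t : ℝ, t ≠ 0 ∧ ∀ F : A, φ (Multiplicative.ofAdd t) F = F

end

end TailBoundary

/-!
The tail boundary consists of limits of bounded harmonic functions of the random walk with step laws
`μ k`: if `F = G k ∘ π_k` for every `k`, the means `H k` of `G k` over the future steps satisfy
`H k t = ∫ H (k + 1) (t + x) ∂μ k`, also after smoothing in `t`. It suffices to find one `τ ≠ 0` that is
a period of all smooth bounded harmonic families (`exists_period_of_harmonic`). Periodicity of `F`
follows by testing against smooth weights in the first variable and boxes of finitely many steps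
(`CompatibleFamily.smoothMean_stepBox_add`, `CompatibleFamily.ae_periodic`), because conditioning on the
first step expresses such a test by tests that begin one step later.

Let `b` be the mass of `β k`. Since `β k` is `1 / b` times the integral of `(δ_x + δ_y) / 2` over
`β k × β k`, the step is, with mass `b`, a fair choice between the points of a pair `(x, y)`.
Conditionally on all pairs, harmonicity expresses `H 0` by iterated averages (`pairAverage`) of `H n`
over translations by `0` or by the differences `d = y - x`. The mass of `β k` times its normalized
variance is comparable with the mean of `d²`. The hypothesis thus says that the measures describing
the mean of `d²` have an infinite sum, and as `|d| ≤ C`, compactness gives a point `a` all of whose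
neighbourhoods have infinite mass (`exists_not_summable_pairDefect`). Hence with probability one the
differences close to `a` have an infinite sum of squares; quantitatively, each step gains a factor
`1 - pairDefect` (`norm_pairAverage_add_sub_le_prod`).

Finally, many differences close to `a` force a period (`exists_asymptotic_period`). By Bessel's
inequality for the fair choices (`sum_norm_sub_sq_add_norm_sq_le`), the increments of the averaged
function over the single differences `d_i` are square summable, with a bound independent of their
number. If `a ≠ 0`, the increments over `d_i ≈ a` are close to that over `a`, so the latter is
small. If `a = 0`, the increments are close to `d_i` times the derivative, and as the sum of the
`d_i²` is large the derivative is small: then every real number is a period.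
-/

namespace TailBoundary

/-! ### Iterated averages over pairs of translations -/

/-- The iterated average of `h` over the pairs of translations by `0` and `d`, for `d` in a list:
`h` convolved with the product of the laws `(δ_0 + δ_d) / 2`, up to reflection. -/
noncomputable def pairAverage : List ℝ → (ℝ → ℂ) → ℝ → ℂ
  | [], h, t => h t
  | d :: D, h, t => (pairAverage D h t + pairAverage D h (t + d)) / 2

@[simp] theorem pairAverage_nil (h : ℝ → ℂ) (t : ℝ) : pairAverage [] h t = h t := rfl

theorem pairAverage_cons (d : ℝ) (D : List ℝ) (h : ℝ → ℂ) (t : ℝ) :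
    pairAverage (d :: D) h t = (pairAverage D h t + pairAverage D h (t + d)) / 2 := rfl

theorem norm_half_add_sq_le (u v : ℂ) : ‖(u + v) / 2‖ ^ 2 ≤ (‖u‖ ^ 2 + ‖v‖ ^ 2) / 2 := by
  have := parallelogram_law_with_norm ℝ u v
  have h2 : ‖(u + v) / 2‖ = ‖u + v‖ / 2 := by simp
  rw [h2]
  nlinarith [sq_nonneg ‖u - v‖]

theorem norm_half_add_sq_add_norm_half_sub_sq (u v : ℂ) :
    ‖u - v‖ ^ 2 / 4 + ‖(u + v) / 2‖ ^ 2 = (‖u‖ ^ 2 + ‖v‖ ^ 2) / 2 := by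
  have := parallelogram_law_with_norm ℝ u v
  have h2 : ‖(u + v) / 2‖ = ‖u + v‖ / 2 := by simp
  rw [h2]
  nlinarith

theorem pairAverage_eq_eraseIdx (h : ℝ → ℂ) (D : List ℝ) (i : Fin D.length) (t : ℝ) :
    pairAverage D h t
      = (pairAverage (D.eraseIdx i) h t + pairAverage (D.eraseIdx i) h (t + D[i])) / 2 := by
  induction D generalizing t with
  | nil => exact i.elim0
  | cons d D ih =>
    refine Fin.cases ?_ (fun j => ?_) i
    · simp [pairAverage_cons]
    · have h1 := ih j t
      have h2 := ih j (t + d)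
      simp only [Fin.val_succ, List.eraseIdx_cons_succ, pairAverage_cons, Fin.getElem_fin,
        List.getElem_cons_succ] at h1 h2 ⊢
      rw [h1, h2, add_right_comm t d]
      ring

/-- Bessel's inequality for the random signs that choose the translations: the differences of `h`
in the direction of each single step, averaged over the other steps, are orthogonal
coefficients of `h`. -/
theorem sum_norm_sub_sq_add_norm_sq_le {M : ℝ} {h : ℝ → ℂ} (hM : ∀ t, ‖h t‖ ≤ M) (D : List ℝ)
    (t : ℝ) :
    ∑ i : Fin D.length, ‖pairAverage (D.eraseIdx i) h t
        - pairAverage (D.eraseIdx i) h (t + D[i])‖ ^ 2 / 4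
      + ‖pairAverage D h t‖ ^ 2 ≤ M ^ 2 := by
  induction D generalizing t with
  | nil =>
    simpa using pow_le_pow_left₀ (norm_nonneg _) (hM t) 2
  | cons d D ih =>
    have h1 := ih t
    have h2 := ih (t + d)
    have h3 := norm_half_add_sq_add_norm_half_sub_sq (pairAverage D h t) (pairAverage D h (t + d))
    have h4 : ∀ i : Fin D.length,
        ‖pairAverage (d :: D.eraseIdx i) h t
          - pairAverage (d :: D.eraseIdx i) h (t + D[i])‖ ^ 2 / 4
        ≤ (‖pairAverage (D.eraseIdx i) h t
            - pairAverage (D.eraseIdx i) h (t + D[i])‖ ^ 2 / 4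
          + ‖pairAverage (D.eraseIdx i) h (t + d)
            - pairAverage (D.eraseIdx i) h (t + d + D[i])‖ ^ 2 / 4) / 2 := by
      intro i
      have := norm_half_add_sq_le (pairAverage (D.eraseIdx i) h t
            - pairAverage (D.eraseIdx i) h (t + D[i])) (pairAverage (D.eraseIdx i) h (t + d)
            - pairAverage (D.eraseIdx i) h (t + d + D[i]))
      have e : pairAverage (d :: D.eraseIdx i) h t
          - pairAverage (d :: D.eraseIdx i) h (t + D[i])
          = (pairAverage (D.eraseIdx i) h t
            - pairAverage (D.eraseIdx i) h (t + D[i]) + (pairAverage (D.eraseIdx i) h (t + d)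
            - pairAverage (D.eraseIdx i) h (t + d + D[i]))) / 2 := by
        rw [pairAverage_cons, pairAverage_cons, add_right_comm t d]
        ring
      rw [e]
      linarith
    have h5 := Finset.sum_le_sum fun i (_ : i ∈ Finset.univ) => h4 i
    rw [← Finset.sum_div Finset.univ (fun i : Fin D.length => _ + _), Finset.sum_add_distrib] at h5
    have h6 : ∑ i : Fin (d :: D).length, ‖pairAverage ((d :: D).eraseIdx i) h t
        - pairAverage ((d :: D).eraseIdx i) h (t + (d :: D)[i])‖ ^ 2 / 4
        = ‖pairAverage D h t - pairAverage D h (t + d)‖ ^ 2 / 4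
          + ∑ i : Fin D.length, ‖pairAverage (d :: D.eraseIdx i) h t
          - pairAverage (d :: D.eraseIdx i) h (t + D[i])‖ ^ 2 / 4 :=
      Fin.sum_univ_succ (n := D.length) _
    rw [h6, pairAverage_cons]
    linarith

/-- Differentiable functions that are bounded by `M`, together with their derivative, and whose
derivative has Lipschitz constant `M`. -/
structure SmoothBound (M : ℝ) (h : ℝ → ℂ) : Prop where
  differentiable : Differentiable ℝ h
  norm_le : ∀ t, ‖h t‖ ≤ M
  norm_deriv_le : ∀ t, ‖deriv h t‖ ≤ M
  norm_deriv_sub_le : ∀ s t, ‖deriv h s - deriv h t‖ ≤ M * |s - t|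

theorem norm_half_add_le {u v : ℂ} {r : ℝ} (hu : ‖u‖ ≤ r) (hv : ‖v‖ ≤ r) :
    ‖(u + v) / 2‖ ≤ r := by
  have h2 : ‖(u + v) / 2‖ = ‖u + v‖ / 2 := by simp
  have := norm_add_le u v
  linarith

theorem deriv_half_add_translate {k : ℝ → ℂ} (hk : Differentiable ℝ k) (d t : ℝ) :
    HasDerivAt (fun t => (k t + k (t + d)) / 2) ((deriv k t + deriv k (t + d)) / 2) t :=
  ((hk t).hasDerivAt.add ((hk (t + d)).hasDerivAt.comp_add_const t d)).div_const 2

theorem SmoothBound.half_add {M : ℝ} {k : ℝ → ℂ} (hk : SmoothBound M k) (d : ℝ) :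
    SmoothBound M (fun t => (k t + k (t + d)) / 2) := by
  have hd := deriv_half_add_translate hk.differentiable d
  refine ⟨fun t => (hd t).differentiableAt, fun t => norm_half_add_le (hk.2 _) (hk.2 _),
    fun t => ?_, fun s t => ?_⟩
  · rw [(hd t).deriv]
    exact norm_half_add_le (hk.3 _) (hk.3 _)
  · rw [(hd t).deriv, (hd s).deriv]
    have e : (deriv k s + deriv k (s + d)) / 2 - (deriv k t + deriv k (t + d)) / 2
        = ((deriv k s - deriv k t) + (deriv k (s + d) - deriv k (t + d))) / 2 := by ring
    rw [e]
    refine norm_half_add_le (hk.4 _ _) ?_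
    simpa using hk.4 (s + d) (t + d)

theorem SmoothBound.pairAverage {M : ℝ} {h : ℝ → ℂ} (hh : SmoothBound M h) (D : List ℝ) :
    SmoothBound M (pairAverage D h) := by
  induction D with
  | nil => exact hh
  | cons d D ih => exact ih.half_add d

theorem SmoothBound.norm_sub_le {M : ℝ} {h : ℝ → ℂ} (hh : SmoothBound M h) (s t : ℝ) :
    ‖h s - h t‖ ≤ M * |s - t| :=
  convex_univ.norm_image_sub_le_of_norm_deriv_le (fun x _ => hh.1 x) (fun x _ => hh.3 x)
    (Set.mem_univ t) (Set.mem_univ s)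

theorem SmoothBound.norm_sub_sub_mul_deriv_le {M : ℝ} {h : ℝ → ℂ} (hh : SmoothBound M h)
    (hM : 0 ≤ M) (t d : ℝ) : ‖h (t + d) - h t - d * deriv h t‖ ≤ M * |d| * |d| := by
  have hd : ∀ s, HasDerivAt (fun s : ℝ => h s - s * deriv h t) (deriv h s - 1 * deriv h t) s :=
    fun s => (hh.1 s).hasDerivAt.sub ((Complex.ofRealCLM.hasDerivAt).mul_const _)
  have := (convex_uIcc t (t + d)).norm_image_sub_le_of_norm_hasDerivWithin_le
    (f := fun s : ℝ => h s - s * deriv h t) (f' := fun s => deriv h s - 1 * deriv h t)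
    (C := M * |d|) (fun s _ => (hd s).hasDerivWithinAt) (fun s hs => ?_)
    Set.left_mem_uIcc Set.right_mem_uIcc
  · simp only [add_sub_cancel_left, Real.norm_eq_abs] at this
    have e : h (t + d) - h t - d * deriv h t
        = h (t + d) - ((t + d : ℝ) : ℂ) * deriv h t - (h t - t * deriv h t) := by
      push_cast
      ring
    rwa [e]
  · rw [one_mul]
    refine (hh.4 s t).trans (mul_le_mul_of_nonneg_left ?_ hM)
    simpa using Set.abs_sub_left_of_mem_uIcc hs

theorem sum_map_eq_sum_fin (D : List ℝ) (f : ℝ → ℝ) :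
    (D.map f).sum = ∑ i : Fin D.length, f D[i] := by
  induction D with
  | nil => simp
  | cons d D ih =>
    rw [List.map_cons, List.sum_cons, ih]
    exact (Fin.sum_univ_succ (n := D.length) fun i => f (d :: D)[i]).symm

/-- If the derivative of the average were larger than `η`, each single increment over a small step `d`
would be at least `|d| η / 2`, which contradicts Bessel's inequality for a large sum of squares. -/
theorem SmoothBound.norm_deriv_pairAverage_le {M η : ℝ} (hM : 0 < M) (hη : 0 < η) {h : ℝ → ℂ}
    (hh : SmoothBound M h) {D : List ℝ} (hD : ∀ d ∈ D, |d| ≤ η / (4 * M))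
    (hK : 16 * M ^ 2 / η ^ 2 < (D.map (· ^ 2)).sum) (t : ℝ) :
    ‖deriv (TailBoundary.pairAverage D h) t‖ ≤ η := by
  by_contra! hlt
  have key : ∀ i : Fin D.length, η ^ 2 / 16 * D[i] ^ 2 ≤
      ‖TailBoundary.pairAverage (D.eraseIdx i) h t
        - TailBoundary.pairAverage (D.eraseIdx i) h (t + D[i])‖ ^ 2 / 4 := by
    intro i
    set d := D[i]
    set k := TailBoundary.pairAverage (D.eraseIdx i) h with hkdef
    have hk : SmoothBound M k := hh.pairAverage _
    have hdi : |d| ≤ η / (4 * M) := hD _ (List.getElem_mem _)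
    have hdM : M * |d| ≤ η / 4 := by
      calc M * |d| ≤ M * (η / (4 * M)) := by gcongr
        _ = η / 4 := by field_simp
    have e : TailBoundary.pairAverage D h = fun t => (k t + k (t + d)) / 2 :=
      funext fun t => pairAverage_eq_eraseIdx h D i t
    have e2 := (deriv_half_add_translate hk.1 d t).deriv
    rw [← e] at e2
    have h1 : ‖deriv k t - (deriv k t + deriv k (t + d)) / 2‖ ≤ η / 4 := by
      have e3 : deriv k t - (deriv k t + deriv k (t + d)) / 2
          = (0 + (deriv k t - deriv k (t + d))) / 2 := by ring
      rw [e3]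
      refine norm_half_add_le (by simpa using by positivity) ((hk.4 _ _).trans ?_)
      simpa using hdM
    have h2 : η * (3 / 4) ≤ ‖deriv k t‖ := by
      have := norm_sub_norm_le ((deriv k t + deriv k (t + d)) / 2) (deriv k t)
      rw [norm_sub_rev] at this
      rw [e2] at hlt
      linarith
    have h3 := hk.norm_sub_sub_mul_deriv_le hM.le t d
    have h4 : |d| * ‖deriv k t‖ - ‖k t - k (t + d)‖ ≤ M * |d| * |d| := by
      have := norm_sub_norm_le ((d : ℂ) * deriv k t) (k (t + d) - k t)
      rw [norm_sub_rev (_ * _), norm_mul, Complex.norm_real, Real.norm_eq_abs,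
        norm_sub_rev (k (t + d)) (k t)] at this
      exact this.trans h3
    have h5 : |d| * (η / 2) ≤ ‖k t - k (t + d)‖ := by
      nlinarith [abs_nonneg d, mul_le_mul_of_nonneg_left h2 (abs_nonneg d),
        mul_le_mul_of_nonneg_right hdM (abs_nonneg d)]
    have h6 := pow_le_pow_left₀ (by positivity) h5 2
    rw [mul_pow, sq_abs] at h6
    linarith
  have h7 := Finset.sum_le_sum fun i (_ : i ∈ Finset.univ) => key i
  rw [← Finset.mul_sum, ← sum_map_eq_sum_fin D (· ^ 2)] at h7
  have h8 := sum_norm_sub_sq_add_norm_sq_le hh.norm_le D t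
  have h9 : η ^ 2 / 16 * (D.map (· ^ 2)).sum ≤ M ^ 2 := by
    nlinarith [sq_nonneg ‖TailBoundary.pairAverage D h t‖]
  rw [div_lt_iff₀ (by positivity)] at hK
  linarith

/-- If the increment of the average over `a` were larger than `η`, the single increments over each step
`d ≈ a`, taken at `t` and at `t + a`, could not both be small; Bessel's inequality at both points
bounds the number of steps. -/
theorem SmoothBound.norm_pairAverage_add_sub_le {M η a : ℝ} (hM : 0 < M) (hη : 0 < η) {h : ℝ → ℂ}
    (hh : SmoothBound M h) {D : List ℝ} (hD : ∀ d ∈ D, |d - a| ≤ η / (2 * M))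
    (hK : 16 * M ^ 2 / η ^ 2 < D.length) (t : ℝ) :
    ‖TailBoundary.pairAverage D h (t + a) - TailBoundary.pairAverage D h t‖ ≤ η := by
  by_contra! hlt
  have key : ∀ i : Fin D.length, η ^ 2 / 8 ≤
      ‖TailBoundary.pairAverage (D.eraseIdx i) h t
        - TailBoundary.pairAverage (D.eraseIdx i) h (t + D[i])‖ ^ 2 / 4
      + ‖TailBoundary.pairAverage (D.eraseIdx i) h (t + a)
        - TailBoundary.pairAverage (D.eraseIdx i) h (t + a + D[i])‖ ^ 2 / 4 := by
    intro i
    have e1 := pairAverage_eq_eraseIdx h D i t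
    have e2 := pairAverage_eq_eraseIdx h D i (t + a)
    set d := D[i]
    set k := TailBoundary.pairAverage (D.eraseIdx i) h with hkdef
    have hk : SmoothBound M k := hh.pairAverage _
    have hdi : |d - a| ≤ η / (2 * M) := hD _ (List.getElem_mem _)
    have hdM : M * |d - a| ≤ η / 2 := by
      calc M * |d - a| ≤ M * (η / (2 * M)) := by gcongr
        _ = η / 2 := by field_simp
    have h1 : ‖k (t + d) - k (t + a)‖ ≤ η / 2 := by
      refine (hk.norm_sub_le _ _).trans ?_
      simpa using hdM
    rw [e1, e2] at hlt
    have e3 : (k (t + a) + k (t + a + d)) / 2 - (k t + k (t + d)) / 2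
      = ((k (t + a) - k (t + d)) + (k (t + a + d) - k (t + a))) / 2
        + ((k (t + d) - k t) + (k (t + a) - k (t + d))) / 2 := by ring
    rw [e3] at hlt
    have h2 : ∀ u v : ℂ, ‖(u + v) / 2‖ ≤ (‖u‖ + ‖v‖) / 2 := fun u v => by
      have : ‖(u + v) / 2‖ = ‖u + v‖ / 2 := by simp
      linarith [norm_add_le u v]
    have h3 := (norm_add_le _ _).trans (add_le_add (h2 (k (t + a) - k (t + d))
      (k (t + a + d) - k (t + a))) (h2 (k (t + d) - k t) (k (t + a) - k (t + d))))
    rw [norm_sub_rev (k (t + a)) (k (t + d)), norm_sub_rev (k (t + a + d)),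
      norm_sub_rev (k (t + d)) (k t)] at h3
    have h4 : η ≤ ‖k t - k (t + d)‖ + ‖k (t + a) - k (t + a + d)‖ := by linarith
    nlinarith [sq_nonneg (‖k t - k (t + d)‖ - ‖k (t + a) - k (t + a + d)‖)]
  have h7 := Finset.sum_le_sum fun i (_ : i ∈ Finset.univ) => key i
  rw [Finset.sum_add_distrib] at h7
  simp only [Finset.sum_const, Finset.card_univ, Fintype.card_fin, nsmul_eq_mul] at h7
  have h8 := sum_norm_sub_sq_add_norm_sq_le hh.norm_le D t
  have h9 := sum_norm_sub_sq_add_norm_sq_le hh.norm_le D (t + a)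
  rw [div_lt_iff₀ (by positivity)] at hK
  nlinarith [sq_nonneg ‖TailBoundary.pairAverage D h t‖,
    sq_nonneg ‖TailBoundary.pairAverage D h (t + a)‖]

/-- Many steps close to `a` force the period `a`; if `a = 0`, steps that are small but have a large
sum of squares force every period. -/
theorem exists_asymptotic_period (a : ℝ) :
    ∃ τ : ℝ, τ ≠ 0 ∧ ∀ M : ℝ, 0 < M → ∀ η : ℝ, 0 < η → ∃ ε > 0, ∃ K : ℝ, ∀ D : List ℝ,
      (∀ d ∈ D, |d - a| ≤ ε) → K ≤ (D.map (· ^ 2)).sum → ∀ h, SmoothBound M h → ∀ t,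
      ‖pairAverage D h (t + τ) - pairAverage D h t‖ ≤ η := by
  by_cases ha : a = 0
  · refine ⟨1, one_ne_zero, fun M hM η hη => ⟨η / (4 * M), by positivity,
      16 * M ^ 2 / η ^ 2 + 1, fun D hD hK h hh t => ?_⟩⟩
    have hd := hh.norm_deriv_pairAverage_le hM hη (D := D) (by simpa [ha] using hD)
      (by linarith)
    simpa using convex_univ.norm_image_sub_le_of_norm_deriv_le
      (fun x _ => (hh.pairAverage D).1 x) (fun x _ => hd x) (Set.mem_univ t) (Set.mem_univ (t + 1))
  · refine ⟨a, ha, fun M hM η hη => ⟨η / (2 * M), by positivity,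
      (16 * M ^ 2 / η ^ 2 + 1) * (|a| + η / (2 * M)) ^ 2, fun D hD hK h hh t => ?_⟩⟩
    refine hh.norm_pairAverage_add_sub_le hM hη hD ?_ t
    have h1 : (D.map (· ^ 2)).sum ≤ D.length * (|a| + η / (2 * M)) ^ 2 := by
      have := List.sum_le_card_nsmul (D.map (· ^ 2)) ((|a| + η / (2 * M)) ^ 2) (by
        intro x hx
        obtain ⟨d, hd, rfl⟩ := List.mem_map.1 hx
        have h2 : |d| ≤ |a| + η / (2 * M) := by
          have := abs_add_le a (d - a)
          rw [add_sub_cancel] at this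
          linarith [hD d hd]
        rw [← sq_abs d]
        gcongr)
      simpa using this
    have h2 : 0 < (|a| + η / (2 * M)) ^ 2 := by positivity
    have := le_of_mul_le_mul_right (hK.trans h1) h2
    linarith

/-! ### Averaging over the steps of the walk -/

/-- The square of `d` if `d` belongs to the window `W`, and zero otherwise. -/
noncomputable def windowSq (W : Set ℝ) (d : ℝ) : ℝ := W.indicator (· ^ 2) d

theorem windowSq_nonneg (W : Set ℝ) (d : ℝ) : 0 ≤ windowSq W d :=
  Set.indicator_nonneg (fun _ _ => sq_nonneg _) d

theorem measurable_windowSq {W : Set ℝ} (hW : MeasurableSet W) : Measurable (windowSq W) :=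
  (measurable_id.pow_const 2).indicator hW

/-- With `b` the mass of `β` and `d` the difference of a pair drawn from `β × β`, divided by `b`,
the integral of `1 - exp (-d²)` over the pairs with `d ∈ W`. -/
noncomputable def pairDefect (β : Measure ℝ) (W : Set ℝ) : ℝ :=
  (β.real Set.univ)⁻¹ * ∫ p, (1 - Real.exp (-windowSq W (p.2 - p.1))) ∂(β.prod β)

theorem integrable_exp_neg_windowSq (β : Measure ℝ) [IsFiniteMeasure β] {W : Set ℝ}
    (hW : MeasurableSet W) :
    Integrable (fun p : ℝ × ℝ => Real.exp (-windowSq W (p.2 - p.1))) (β.prod β) := by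
  refine Integrable.of_bound (C := 1) ?_ (Filter.Eventually.of_forall fun p => ?_)
  · exact (Real.measurable_exp.comp ((measurable_windowSq hW).comp
      (measurable_snd.sub measurable_fst)).neg).aestronglyMeasurable
  · rw [Real.norm_eq_abs, abs_of_pos (Real.exp_pos _), Real.exp_le_one_iff]
    linarith [windowSq_nonneg W (p.2 - p.1)]

theorem integral_exp_neg_windowSq (β : Measure ℝ) [IsFiniteMeasure β] {W : Set ℝ}
    (hW : MeasurableSet W) (hβ : β.real Set.univ ≠ 0) :
    (β.real Set.univ)⁻¹ * ∫ p, Real.exp (-windowSq W (p.2 - p.1)) ∂(β.prod β)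
      = β.real Set.univ - pairDefect β W := by
  rw [pairDefect, integral_sub (integrable_const _) (integrable_exp_neg_windowSq β hW)]
  rw [integral_const, ← Set.univ_prod_univ, measureReal_prod_prod]
  simp only [smul_eq_mul, mul_one]
  field_simp
  ring

theorem pairDefect_le (β : Measure ℝ) [IsFiniteMeasure β] {W : Set ℝ}
    (hW : MeasurableSet W) : pairDefect β W ≤ β.real Set.univ := by
  by_cases hβ : β.real Set.univ = 0
  · simp [pairDefect, hβ]
  · have := integral_exp_neg_windowSq β hW hβ
    have h2 : 0 ≤ (β.real Set.univ)⁻¹ * ∫ p, Real.exp (-windowSq W (p.2 - p.1)) ∂(β.prod β) :=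
      mul_nonneg (by positivity) (integral_nonneg fun _ => (Real.exp_pos _).le)
    linarith

/-- A step with law `ν ≥ β` is, with the mass `b` of `β`, a fair choice between the points of a pair
drawn from `β × β`. A bound for the fair averages that gains a factor `exp (-d²)` on the pairs
with difference `d ∈ W` thus gains the factor `1 - pairDefect β W` for the whole step. -/
theorem norm_integral_le_of_pairs {ν β : Measure ℝ} [IsProbabilityMeasure ν] [IsFiniteMeasure β]
    (hβν : β ≤ ν) {W : Set ℝ} (hW : MeasurableSet W) {f : ℝ → ℂ} (hf : Continuous f) {B R : ℝ}
    (h1 : ∀ x, ‖f x‖ ≤ B + R)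
    (h2 : ∀ x y, ‖(f x + f y) / 2‖ ≤ B + R * Real.exp (-windowSq W (y - x))) :
    ‖∫ x, f x ∂ν‖ ≤ B + R * (1 - pairDefect β W) := by
  have hfi : ∀ (ρ : Measure ℝ) [IsFiniteMeasure ρ], Integrable f ρ := fun ρ _ =>
    Integrable.of_bound hf.aestronglyMeasurable _ (Filter.Eventually.of_forall h1)
  have hadd : ν - β + β = ν := Measure.sub_add_cancel_of_le hβν
  have hmass : (ν - β).real Set.univ = 1 - β.real Set.univ := by
    have h : (ν - β).real Set.univ + β.real Set.univ = 1 := by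
      rw [← measureReal_add_apply, hadd, probReal_univ]
    linarith
  have hA : ‖∫ x, f x ∂(ν - β)‖ ≤ (B + R) * (1 - β.real Set.univ) := by
    have := norm_integral_le_of_norm_le_const (μ := ν - β) (Filter.Eventually.of_forall h1)
    rwa [hmass] at this
  have hB : ‖∫ x, f x ∂β‖ ≤ B * β.real Set.univ + R * (β.real Set.univ - pairDefect β W) := by
    by_cases hβ : β.real Set.univ = 0
    · have : β = 0 := by
        rw [measureReal_def, ENNReal.toReal_eq_zero_iff] at hβ
        simpa using hβ
      subst this
      simp [pairDefect]
    · set b := β.real Set.univ with hb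
      have e : ∫ p, (f p.1 + f p.2) / 2 ∂(β.prod β) = b * ∫ x, f x ∂β := by
        have i1 : Integrable (fun p : ℝ × ℝ => f p.1) (β.prod β) := (hfi β).comp_fst β
        have i2 : Integrable (fun p : ℝ × ℝ => f p.2) (β.prod β) := (hfi β).comp_snd β
        rw [integral_div, integral_add i1 i2, integral_fun_fst, integral_fun_snd, ← hb]
        simp only [Complex.real_smul]
        ring
      have hle : ‖∫ p, (f p.1 + f p.2) / 2 ∂(β.prod β)‖
          ≤ ∫ p, (B + R * Real.exp (-windowSq W (p.2 - p.1))) ∂(β.prod β) :=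
        norm_integral_le_of_norm_le ((integrable_const _).add
          ((integrable_exp_neg_windowSq β hW).const_mul _))
          (Filter.Eventually.of_forall fun p => h2 p.1 p.2)
      rw [integral_add (integrable_const _) ((integrable_exp_neg_windowSq β hW).const_mul _),
        integral_const_mul, integral_const, ← Set.univ_prod_univ, measureReal_prod_prod, ← hb,
        e, norm_mul, Complex.norm_real, Real.norm_eq_abs, abs_of_nonneg measureReal_nonneg,
        smul_eq_mul] at hle
      have hbpos : 0 < b := lt_of_le_of_ne measureReal_nonneg (Ne.symm hβ)
      rw [← integral_exp_neg_windowSq β hW hβ, ← hb]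
      have h3 := mul_le_mul_of_nonneg_left hle (inv_nonneg.2 hbpos.le)
      rw [← mul_assoc, inv_mul_cancel₀ hβ, one_mul] at h3
      refine h3.trans (le_of_eq ?_)
      field_simp
  rw [← hadd, integral_add_measure (hfi _) (hfi _)]
  refine (norm_add_le _ _).trans ((add_le_add hA hB).trans (le_of_eq ?_))
  ring

theorem pairAverage_integral {ν : Measure ℝ} [IsProbabilityMeasure ν] {h₀ h₁ : ℝ → ℂ} {M : ℝ}
    (h₁M : SmoothBound M h₁) (heq : ∀ t, h₀ t = ∫ x, h₁ (t + x) ∂ν) (D : List ℝ) (t : ℝ) :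
    pairAverage D h₀ t = ∫ x, pairAverage D h₁ (t + x) ∂ν := by
  have hi : ∀ (D : List ℝ) t, Integrable (fun x => pairAverage D h₁ (t + x)) ν := fun D t =>
    Integrable.of_bound (((h₁M.pairAverage D).1.continuous.comp (by fun_prop)).aestronglyMeasurable)
      M (Filter.Eventually.of_forall fun x => (h₁M.pairAverage D).2 _)
  induction D generalizing t with
  | nil => exact heq t
  | cons d D ih =>
    simp only [pairAverage_cons]
    rw [integral_div, ih, ih, ← integral_add (hi D t) (hi D (t + d))]
    simp only [add_right_comm]

/-- A bounded family `H` that is harmonic for a random walk whose step laws dominate the measures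
`β k` is almost `τ`-periodic, as soon as many differences in `W` force almost `τ`-periodicity.
The list `D` holds the differences that were collected from earlier steps. -/
theorem norm_pairAverage_add_sub_le_prod {μ β : ℕ → Measure ℝ} [∀ n, IsProbabilityMeasure (μ n)]
    [∀ n, IsFiniteMeasure (β n)] (hβμ : ∀ n, β n ≤ μ n) {H : ℕ → ℝ → ℂ} {M : ℝ}
    (hM : 0 ≤ M)
    (hH : ∀ k, SmoothBound M (H k)) (hharm : ∀ k t, H k t = ∫ x, H (k + 1) (t + x) ∂μ k)
    {W : Set ℝ} (hW : MeasurableSet W) {τ η K : ℝ} (hη : 0 ≤ η)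
    (hdet : ∀ D : List ℝ, (∀ d ∈ D, d ∈ W) → K ≤ (D.map (· ^ 2)).sum → ∀ k t,
      ‖pairAverage D (H k) (t + τ) - pairAverage D (H k) t‖ ≤ η)
    (j : ℕ) : ∀ (k : ℕ) (D : List ℝ), (∀ d ∈ D, d ∈ W) → ∀ t,
      ‖pairAverage D (H k) (t + τ) - pairAverage D (H k) t‖
        ≤ η + 2 * M * Real.exp (K - (D.map (· ^ 2)).sum)
          * ∏ i ∈ Finset.range j, (1 - pairDefect (β (k + i)) W) := by
  induction j with
  | zero =>
    intro k D hD t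
    rw [Finset.prod_range_zero, mul_one]
    by_cases hK : K ≤ (D.map (· ^ 2)).sum
    · exact (hdet D hD hK k t).trans (le_add_of_nonneg_right (by positivity))
    · have h1 := norm_sub_le (pairAverage D (H k) (t + τ)) (pairAverage D (H k) t)
      have h2 := ((hH k).pairAverage D).norm_le
      have h3 : (1 : ℝ) ≤ Real.exp (K - (D.map (· ^ 2)).sum) := by
        rw [Real.one_le_exp_iff]
        linarith
      nlinarith [h2 (t + τ), h2 t]
  | succ j ih =>
    intro k D hD t
    have hs := (hH (k + 1)).pairAverage D
    set g := pairAverage D (H (k + 1)) with hg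
    have hi : ∀ t, Integrable (fun x => g (t + x)) (μ k) := fun t =>
      Integrable.of_bound ((hs.1.continuous.comp (by fun_prop)).aestronglyMeasurable)
        M (Filter.Eventually.of_forall fun x => hs.2 _)
    rw [pairAverage_integral (hH (k + 1)) (hharm k), pairAverage_integral (hH (k + 1)) (hharm k),
      ← integral_sub (hi _) (hi _), Finset.prod_range_succ', add_zero,
      ← mul_assoc]
    have hprod : ∏ i ∈ Finset.range j, (1 - pairDefect (β (k + (i + 1))) W)
        = ∏ i ∈ Finset.range j, (1 - pairDefect (β (k + 1 + i)) W) :=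
      Finset.prod_congr rfl fun i _ => by rw [add_comm i 1, add_assoc]
    rw [hprod]
    have hgc := hs.1.continuous
    refine norm_integral_le_of_pairs (hβμ k) hW (by fun_prop) (fun x => ?_) fun x y => ?_
    · rw [add_right_comm]
      exact ih (k + 1) D hD (t + x)
    -- A pair with difference in the window adds that difference to the list; other pairs are bounded
    -- at each of their points.
    · by_cases hd : y - x ∈ W
      · have h1 := ih (k + 1) ((y - x) :: D) (by simpa [hd] using hD) (t + x)
        rw [pairAverage_cons, pairAverage_cons, ← hg] at h1
        have e : (g (t + τ + x) - g (t + x) + (g (t + τ + y) - g (t + y))) / 2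
          = (g (t + x + τ) + g (t + x + τ + (y - x))) / 2
            - (g (t + x) + g (t + x + (y - x))) / 2 := by
          rw [show t + x + τ = t + τ + x by ring, show t + τ + x + (y - x) = t + τ + y by ring,
            show t + x + (y - x) = t + y by ring]
          ring
        rw [e]
        refine h1.trans (le_of_eq ?_)
        rw [windowSq, Set.indicator_of_mem hd, List.map_cons, List.sum_cons,
          show ∀ a b c : ℝ, a - (b + c) = a - c + -b from fun a b c => by ring, Real.exp_add]
        ring
      · rw [windowSq, Set.indicator_of_notMem hd, neg_zero, Real.exp_zero, mul_one]
        refine norm_half_add_le ?_ ?_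
        · rw [add_right_comm]
          exact ih (k + 1) D hD (t + x)
        · rw [add_right_comm]
          exact ih (k + 1) D hD (t + y)

/-! ### Differences that accumulate, and the common period of harmonic functions -/

/-- With `b` the mass of `β` and `d` the difference of a pair drawn from `β × β`, divided by `b`,
the distribution of `d` weighted by `d²`. -/
noncomputable def sqDiffMeasure (β : Measure ℝ) : Measure ℝ :=
  (β Set.univ)⁻¹ • ((β.prod β).withDensity fun p => ENNReal.ofReal ((p.2 - p.1) ^ 2)).map
    fun p => p.2 - p.1

theorem sqDiffMeasure_apply (β : Measure ℝ) [SFinite β] {W : Set ℝ} (hW : MeasurableSet W) :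
    sqDiffMeasure β W = (β Set.univ)⁻¹ *
      ∫⁻ p, ENNReal.ofReal (windowSq W (p.2 - p.1)) ∂(β.prod β) := by
  have hm : Measurable fun p : ℝ × ℝ => p.2 - p.1 := measurable_snd.sub measurable_fst
  rw [sqDiffMeasure, Measure.smul_apply, smul_eq_mul, Measure.map_apply hm hW,
    withDensity_apply _ (hm hW), ← lintegral_indicator (hm hW)]
  congr 2
  ext p
  by_cases hp : p.2 - p.1 ∈ W
  · rw [Set.indicator_of_mem (by exact hp), windowSq, Set.indicator_of_mem hp]
  · rw [Set.indicator_of_notMem (by exact hp), windowSq, Set.indicator_of_notMem hp,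
      ENNReal.ofReal_zero]

/-- The variance of a probability measure is at most the mean square of the difference of two
independent samples. -/
theorem evariance_id_le (ν : Measure ℝ) [IsProbabilityMeasure ν] (hν : Integrable id ν) :
    evariance id ν ≤ ∫⁻ x, ∫⁻ y, ENNReal.ofReal ((y - x) ^ 2) ∂ν ∂ν := by
  rw [evariance]
  refine lintegral_mono fun x => ?_
  have e : id x - ∫ y, id y ∂ν = ∫ y, (x - y) ∂ν := by
    rw [integral_sub (g := fun y => y) (integrable_const x) hν]
    simp
  have h1 : ‖∫ y, (x - y) ∂ν‖ₑ ≤ ∫⁻ y, ‖x - y‖ₑ ∂ν := enorm_integral_le_lintegral_enorm _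
  have h2 := ENNReal.lintegral_mul_le_Lp_mul_Lq ν Real.HolderConjugate.two_two
    (f := fun y => ‖x - y‖ₑ) (g := fun _ => 1)
    (by fun_prop) (by fun_prop)
  simp only [Pi.mul_apply, mul_one, ENNReal.one_rpow, lintegral_const, measure_univ] at h2
  have h3 := ENNReal.rpow_le_rpow (z := 2) (h1.trans h2) (by norm_num)
  rw [← ENNReal.rpow_mul] at h3
  norm_num at h3
  rw [e]
  refine h3.trans (lintegral_mono fun y => ?_)
  rw [← ofReal_norm, ← ENNReal.ofReal_pow (norm_nonneg _), Real.norm_eq_abs, sq_abs]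
  exact ENNReal.ofReal_le_ofReal (by nlinarith)

/-- The weight in the variance hypothesis is bounded by the total mean of the squared differences. The
bound on the width makes the normalized measure integrable, so that its variance is not junk. -/
theorem mul_evariance_le_sqDiffMeasure (β : Measure ℝ) [IsFiniteMeasure β] {C : ℝ}
    (hwidth : ∀ᵐ p ∂(β.prod β), |p.1 - p.2| ≤ C) :
    β Set.univ * evariance id ((β Set.univ)⁻¹ • β) ≤ sqDiffMeasure β Set.univ := by
  by_cases hβ : β Set.univ = 0
  · simp [hβ]
  have hβt : β Set.univ ≠ ∞ := measure_ne_top β _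
  have hprob : IsProbabilityMeasure ((β Set.univ)⁻¹ • β) :=
    ⟨by simp [ENNReal.inv_mul_cancel hβ hβt]⟩
  have hint : Integrable id ((β Set.univ)⁻¹ • β) := by
    refine Integrable.smul_measure ?_ (ENNReal.inv_ne_top.2 hβ)
    have h1 := Measure.ae_ae_of_ae_prod hwidth
    have : NeZero β := ⟨fun h => hβ (by simp [h])⟩
    obtain ⟨x, hx⟩ := h1.exists
    refine Integrable.of_bound (C := |x| + C) aestronglyMeasurable_id ?_
    filter_upwards [hx] with y hy
    have := abs_sub_abs_le_abs_sub y x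
    rw [abs_sub_comm] at this
    simp only [id, Real.norm_eq_abs]
    linarith
  refine (mul_le_mul_right (evariance_id_le _ hint) _).trans (le_of_eq ?_)
  rw [sqDiffMeasure_apply β MeasurableSet.univ, lintegral_prod _ (by
    unfold windowSq
    simp only [Set.indicator_univ]
    fun_prop)]
  simp only [lintegral_smul_measure, windowSq, Set.indicator_univ, smul_eq_mul]
  rw [lintegral_const_mul' _ _ (ENNReal.inv_ne_top.2 hβ), ← mul_assoc,
    ENNReal.mul_inv_cancel hβ hβt, one_mul]

theorem le_mul_one_sub_exp_neg {C w : ℝ} (h0 : 0 ≤ w) (hw : w ≤ C) :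
    w ≤ (1 + C) * (1 - Real.exp (-w)) := by
  have h1 : Real.exp (-w) * (1 + w) ≤ 1 := by
    calc Real.exp (-w) * (1 + w) ≤ Real.exp (-w) * Real.exp w := by
          gcongr
          linarith [Real.add_one_le_exp w]
      _ = 1 := by rw [← Real.exp_add]; simp
  have h2 : 0 ≤ 1 - Real.exp (-w) := by
    rw [sub_nonneg, Real.exp_le_one_iff]
    linarith
  nlinarith

/-- On differences bounded by `C`, the weight `d²` is comparable with `1 - exp (-d²)`. -/
theorem sqDiffMeasure_le_pairDefect (β : Measure ℝ) [IsFiniteMeasure β] {C : ℝ}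
    (hwidth : ∀ᵐ p ∂(β.prod β), |p.1 - p.2| ≤ C) {W : Set ℝ} (hW : MeasurableSet W) :
    sqDiffMeasure β W ≤ ENNReal.ofReal (1 + C ^ 2) * ENNReal.ofReal (pairDefect β W) := by
  by_cases hβ : β Set.univ = 0
  · have : β = 0 := by simpa using hβ
    simp [sqDiffMeasure, this]
  have hβt : β Set.univ ≠ ∞ := measure_ne_top β _
  have hint : Integrable (fun p : ℝ × ℝ => 1 - Real.exp (-windowSq W (p.2 - p.1))) (β.prod β) :=
    (integrable_const _).sub (integrable_exp_neg_windowSq β hW)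
  have e : ENNReal.ofReal (pairDefect β W) = (β Set.univ)⁻¹ *
      ∫⁻ p, ENNReal.ofReal (1 - Real.exp (-windowSq W (p.2 - p.1))) ∂(β.prod β) := by
    rw [pairDefect, ENNReal.ofReal_mul (by positivity), measureReal_def,
      ENNReal.ofReal_inv_of_pos (ENNReal.toReal_pos hβ hβt), ENNReal.ofReal_toReal hβt,
      ofReal_integral_eq_lintegral_ofReal hint]
    refine Filter.Eventually.of_forall fun p => ?_
    simp only [Pi.zero_apply, sub_nonneg, Real.exp_le_one_iff, neg_nonpos]
    exact windowSq_nonneg _ _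
  rw [e, sqDiffMeasure_apply β hW, mul_left_comm, ← lintegral_const_mul' _ _ ENNReal.ofReal_ne_top]
  gcongr 1
  refine lintegral_mono_ae ?_
  filter_upwards [hwidth] with p hp
  rw [← ENNReal.ofReal_mul (by positivity)]
  refine ENNReal.ofReal_le_ofReal (le_mul_one_sub_exp_neg (windowSq_nonneg _ _) ?_)
  refine (Set.indicator_le_self' (fun _ _ => sq_nonneg _) _).trans ?_
  rw [← sq_abs, abs_sub_comm]
  gcongr

/-- There is a difference `a` near which the differences accumulate: otherwise the sum of the measures
`sqDiffMeasure (β n)` would be finite on the compact interval `[-C, C]` that carries it. -/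
theorem exists_not_summable_pairDefect {β : ℕ → Measure ℝ} [∀ n, IsFiniteMeasure (β n)] {C : ℝ}
    (hwidth : ∀ n, ∀ᵐ p ∂((β n).prod (β n)), |p.1 - p.2| ≤ C)
    (hvar : ∑' n, β n Set.univ * evariance id ((β n Set.univ)⁻¹ • β n) = ∞) :
    ∃ a : ℝ, ∀ ε > 0, ¬ Summable fun n => pairDefect (β n) (Metric.closedBall a ε) := by
  set m : Measure ℝ := Measure.sum fun n => sqDiffMeasure (β n) with hm
  have hle : ∀ W, MeasurableSet W → m W ≤
      ENNReal.ofReal (1 + C ^ 2) * ∑' n, ENNReal.ofReal (pairDefect (β n) W) := by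
    intro W hW
    rw [hm, Measure.sum_apply _ hW, ← ENNReal.tsum_mul_left]
    exact ENNReal.tsum_le_tsum fun n => sqDiffMeasure_le_pairDefect (β n) (hwidth n) hW
  have hout : m (Set.Icc (-C) C)ᶜ = 0 := by
    rw [hm, Measure.sum_apply _ measurableSet_Icc.compl, ENNReal.tsum_eq_zero]
    intro n
    rw [sqDiffMeasure_apply _ measurableSet_Icc.compl]
    refine mul_eq_zero_of_right _ ?_
    rw [← lintegral_zero]
    refine lintegral_congr_ae ?_
    filter_upwards [hwidth n] with p hp
    rw [windowSq, Set.indicator_of_notMem, ENNReal.ofReal_zero]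
    rw [Set.notMem_compl_iff, Set.mem_Icc, ← abs_le, abs_sub_comm]
    exact hp
  have htop : m (Set.Icc (-C) C) = ∞ := by
    have h1 : m Set.univ = ∞ := by
      rw [eq_top_iff, ← hvar, hm, Measure.sum_apply _ MeasurableSet.univ]
      exact ENNReal.tsum_le_tsum fun n => mul_evariance_le_sqDiffMeasure (β n) (hwidth n)
    rw [← measure_add_measure_compl (measurableSet_Icc (a := -C) (b := C)), hout, add_zero] at h1
    exact h1
  by_contra! hcon
  refine (isCompact_Icc.measure_lt_top_of_nhdsWithin fun a _ => ?_).ne htop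
  obtain ⟨ε, hε, hs⟩ := hcon a
  refine ⟨Metric.closedBall a ε, mem_nhdsWithin_of_mem_nhds (Metric.closedBall_mem_nhds a hε),
    (hle _ Metric.isClosed_closedBall.measurableSet).trans_lt
      (ENNReal.mul_lt_top ENNReal.ofReal_lt_top ?_)⟩
  exact hs.tsum_ofReal_lt_top

theorem pairDefect_nonneg (β : Measure ℝ) (W : Set ℝ) : 0 ≤ pairDefect β W := by
  refine mul_nonneg (by positivity) (integral_nonneg fun p => ?_)
  simp only [Pi.zero_apply, sub_nonneg, Real.exp_le_one_iff, neg_nonpos]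
  exact windowSq_nonneg _ _

theorem tendsto_prod_one_sub_of_not_summable {q : ℕ → ℝ} (h0 : ∀ n, 0 ≤ q n) (h1 : ∀ n, q n ≤ 1)
    (hq : ¬ Summable q) :
    Filter.Tendsto (fun j => ∏ i ∈ Finset.range j, (1 - q i)) Filter.atTop (nhds 0) := by
  have h := (not_summable_iff_tendsto_nat_atTop_of_nonneg h0).1 hq
  refine squeeze_zero (fun j => Finset.prod_nonneg fun i _ => sub_nonneg.2 (h1 i)) (fun j => ?_)
    (Real.tendsto_exp_neg_atTop_nhds_zero.comp h)
  rw [Function.comp, ← Finset.sum_neg_distrib, Real.exp_sum]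
  exact Finset.prod_le_prod (fun i _ => sub_nonneg.2 (h1 i)) fun i _ => by
    linarith [Real.add_one_le_exp (-q i)]

/-- All smooth bounded harmonic families of the time-dependent walk have a common period. -/
theorem exists_period_of_harmonic {μ β : ℕ → Measure ℝ} [∀ n, IsProbabilityMeasure (μ n)]
    [∀ n, IsFiniteMeasure (β n)] (hβμ : ∀ n, β n ≤ μ n) {C : ℝ}
    (hwidth : ∀ n, ∀ᵐ p ∂((β n).prod (β n)), |p.1 - p.2| ≤ C)
    (hvar : ∑' n, β n Set.univ * evariance id ((β n Set.univ)⁻¹ • β n) = ∞) :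
    ∃ τ : ℝ, τ ≠ 0 ∧ ∀ (M : ℝ) (H : ℕ → ℝ → ℂ), 0 < M → (∀ k, SmoothBound M (H k)) →
      (∀ k t, H k t = ∫ x, H (k + 1) (t + x) ∂μ k) → ∀ k t, H k (t + τ) = H k t := by
  obtain ⟨a, ha⟩ := exists_not_summable_pairDefect hwidth hvar
  obtain ⟨τ, hτ, hper⟩ := exists_asymptotic_period a
  refine ⟨τ, hτ, fun M H hM hH hharm k t => ?_⟩
  rw [← sub_eq_zero, ← norm_le_zero_iff]
  refine le_of_forall_pos_le_add fun η hη => ?_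
  rw [zero_add]
  obtain ⟨ε, hε, K, hdet⟩ := hper M hM η hη
  have hW : MeasurableSet (Metric.closedBall a ε) := Metric.isClosed_closedBall.measurableSet
  have hprod := tendsto_prod_one_sub_of_not_summable
    (q := fun i => pairDefect (β (k + i)) (Metric.closedBall a ε))
    (fun _ => pairDefect_nonneg _ _) (fun i => (pairDefect_le _ hW).trans ?_) (by
      simp only [add_comm k]
      rw [summable_nat_add_iff (f := fun n => pairDefect (β n) (Metric.closedBall a ε)) k]
      exact ha ε hε)
  · refine ge_of_tendsto' (((hprod.const_mul (2 * M * Real.exp (K - 0))).const_add η).trans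
      (by simp)) fun j => ?_
    simpa using norm_pairAverage_add_sub_le_prod hβμ hM.le hH hharm hW hη.le
      (fun D hD hK k t => hdet D (fun d hd => by simpa [Real.dist_eq] using hD d hd) hK _ (hH k) t)
      j k [] (by simp) t
  · rw [← probReal_univ (μ := μ (k + i))]
    exact ENNReal.toReal_mono (measure_ne_top _ _) (hβμ _ _)

/-! ### Elements of the tail boundary and harmonic families -/

/-- A step `x` followed by a sequence of steps. -/
def consStep (p : ℝ × (ℕ → ℝ)) : ℕ → ℝ := fun n => Nat.casesOn n p.1 p.2

theorem measurable_consStep : Measurable consStep :=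
  measurable_pi_lambda _ fun n => by
    cases n with
    | zero => exact measurable_fst
    | succ n => exact (measurable_pi_apply n).comp measurable_snd

theorem measurePreserving_consStep (μ : ℕ → Measure ℝ) [∀ k, IsProbabilityMeasure (μ k)] (k : ℕ) :
    MeasurePreserving consStep ((μ k).prod (stepLaw μ (k + 1))) (stepLaw μ k) := by
  refine ⟨measurable_consStep, ?_⟩
  refine Measure.eq_infinitePi (fun n => μ (n + k)) fun s t ht => ?_
  rw [Measure.map_apply measurable_consStep (MeasurableSet.pi s.countable_toSet fun i _ => ht i)]
  set s' : Finset ℕ := s.preimage (· + 1) (add_left_injective 1).injOn with hs'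
  have hmem : ∀ j, j ∈ s' ↔ j + 1 ∈ s := fun j => by rw [hs', Finset.mem_preimage]
  have e : consStep ⁻¹' (Set.pi s t)
      = (if 0 ∈ s then t 0 else Set.univ) ×ˢ Set.pi (s' : Set ℕ) (fun j => t (j + 1)) := by
    ext ⟨x, ω⟩
    simp only [Set.mem_preimage, Set.mem_pi, Set.mem_prod, SetLike.mem_coe, hmem]
    constructor
    · intro h
      refine ⟨?_, fun i hi => h (i + 1) hi⟩
      split_ifs with h0
      · exact h 0 h0
      · trivial
    · rintro ⟨h0, h1⟩ i hi
      cases i with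
      | zero => simpa [hi, consStep] using h0
      | succ i => exact h1 i hi
  rw [e, Measure.prod_prod]
  have e2 : stepLaw μ (k + 1) (Set.pi (s' : Set ℕ) (fun j => t (j + 1)))
      = ∏ j ∈ s', μ (j + 1 + k) (t (j + 1)) := by
    rw [stepLaw, Measure.infinitePi_pi (μ := fun j => μ (j + (k + 1))) (fun i _ => ht _)]
    refine Finset.prod_congr rfl fun j _ => ?_
    rw [add_assoc, add_comm 1 k]
  rw [e2]
  have e3 : ∏ j ∈ s', μ (j + 1 + k) (t (j + 1)) = ∏ i ∈ s.erase 0, μ (i + k) (t i) := by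
    refine Finset.prod_bij (fun j _ => j + 1)
      (fun j hj => Finset.mem_erase.2 ⟨Nat.succ_ne_zero j, (hmem j).1 hj⟩) (by simp) (fun i hi => ?_)
      (by simp)
    obtain ⟨h0, hi⟩ := Finset.mem_erase.1 hi
    obtain ⟨j, rfl⟩ := Nat.exists_eq_succ_of_ne_zero h0
    exact ⟨j, (hmem j).2 hi, rfl⟩
  rw [e3]
  split_ifs with h0
  · rw [← Finset.mul_prod_erase s _ h0, zero_add]
  · rw [measure_univ, one_mul, Finset.erase_eq_of_notMem h0]

/-- A bounded measurable family of functions `G k` on `ℝ × Ω_k`, such that `G k` is `G (k + 1)` after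
one step of the walk: the versions on the future spaces of a single element of the tail boundary. -/
structure CompatibleFamily (μ : ℕ → Measure ℝ) [∀ k, IsProbabilityMeasure (μ k)] (M : ℝ)
    (G : ℕ → ℝ × (ℕ → ℝ) → ℂ) : Prop where
  measurable : ∀ k, Measurable (G k)
  norm_le : ∀ k p, ‖G k p‖ ≤ M
  step : ∀ k, ∀ᵐ p ∂((volume : Measure ℝ).prod (stepLaw μ k)),
    G k p = G (k + 1) (p.1 + p.2 0, fun n => p.2 (n + 1))

/-- The integral of `G k` over the future steps in `E`, as a function of the position. -/
noncomputable def futureMean (μ : ℕ → Measure ℝ) [∀ k, IsProbabilityMeasure (μ k)]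
    (G : ℕ → ℝ × (ℕ → ℝ) → ℂ) (k : ℕ) (E : Set (ℕ → ℝ)) (t : ℝ) : ℂ :=
  ∫ ω in E, G k (t, ω) ∂stepLaw μ k

/-- The mean `futureMean` smoothed by the weight `ψ` around the position `s`. -/
noncomputable def smoothMean (μ : ℕ → Measure ℝ) [∀ k, IsProbabilityMeasure (μ k)]
    (G : ℕ → ℝ × (ℕ → ℝ) → ℂ) (ψ : ℝ → ℝ) (k : ℕ) (E : Set (ℕ → ℝ)) (s : ℝ) : ℂ :=
  ∫ u, ψ u • futureMean μ G k E (s + u)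

section

variable {μ : ℕ → Measure ℝ} [∀ k, IsProbabilityMeasure (μ k)] {M : ℝ}
  {G : ℕ → ℝ × (ℕ → ℝ) → ℂ}

theorem CompatibleFamily.measurable_futureMean (hG : CompatibleFamily μ M G) (k : ℕ)
    (E : Set (ℕ → ℝ)) : Measurable (futureMean μ G k E) :=
  ((hG.measurable k).stronglyMeasurable.integral_prod_right'
    (ν := (stepLaw μ k).restrict E)).measurable

theorem CompatibleFamily.norm_futureMean_le (hG : CompatibleFamily μ M G) (k : ℕ)
    (E : Set (ℕ → ℝ)) (t : ℝ) : ‖futureMean μ G k E t‖ ≤ M := by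
  have h0 : 0 ≤ M := (norm_nonneg _).trans (hG.norm_le 0 (0, 0))
  refine (norm_integral_le_of_norm_le_const
    (Filter.Eventually.of_forall fun ω => hG.norm_le k (t, ω))).trans ?_
  have : ((stepLaw μ k).restrict E).real Set.univ ≤ 1 := by
    rw [measureReal_restrict_apply MeasurableSet.univ]
    exact measureReal_le_one
  nlinarith

/-- Conditioning on the first step. With no restriction on the steps this is harmonicity. -/
theorem CompatibleFamily.futureMean_eq (hG : CompatibleFamily μ M G) (k : ℕ) {B : Set ℝ}
    (hB : MeasurableSet B) {E : Set (ℕ → ℝ)} (hE : MeasurableSet E) :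
    ∀ᵐ t, futureMean μ G k {ω | ω 0 ∈ B ∧ (fun n => ω (n + 1)) ∈ E} t
      = ∫ x in B, futureMean μ G (k + 1) E (t + x) ∂μ k := by
  filter_upwards [Measure.ae_ae_of_ae_prod (hG.step k)] with t ht
  have hset : MeasurableSet {ω : ℕ → ℝ | ω 0 ∈ B ∧ (fun n => ω (n + 1)) ∈ E} :=
    (measurable_pi_apply 0 hB).inter
      ((by fun_prop : Measurable fun (ω : ℕ → ℝ) n => ω (n + 1)) hE)
  have hpre : consStep ⁻¹' {ω : ℕ → ℝ | ω 0 ∈ B ∧ (fun n => ω (n + 1)) ∈ E} = B ×ˢ E := rfl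
  have hmp := (measurePreserving_consStep μ k).restrict_preimage hset
  rw [hpre, ← Measure.prod_restrict] at hmp
  have hm : Measurable fun ω : ℕ → ℝ => G (k + 1) (t + ω 0, fun n => ω (n + 1)) :=
    (hG.measurable (k + 1)).comp (by fun_prop)
  rw [futureMean, integral_congr_ae (ae_restrict_of_ae ht), ← hmp.map_eq,
    integral_map hmp.measurable.aemeasurable hm.aestronglyMeasurable, integral_prod]
  · rfl
  · exact Integrable.of_bound (hm.comp hmp.measurable).aestronglyMeasurable M
      (Filter.Eventually.of_forall fun p => hG.norm_le _ _)

theorem CompatibleFamily.smoothMean_eq (hG : CompatibleFamily μ M G) {ψ : ℝ → ℝ}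
    (hψ : Integrable ψ) (k : ℕ) {B : Set ℝ} (hB : MeasurableSet B) {E : Set (ℕ → ℝ)}
    (hE : MeasurableSet E) (s : ℝ) :
    smoothMean μ G ψ k {ω | ω 0 ∈ B ∧ (fun n => ω (n + 1)) ∈ E} s
      = ∫ x in B, smoothMean μ G ψ (k + 1) E (s + x) ∂μ k := by
  have hae := (measurePreserving_add_left volume s).quasiMeasurePreserving.ae
    (hG.futureMean_eq k hB hE)
  have e : smoothMean μ G ψ k {ω | ω 0 ∈ B ∧ (fun n => ω (n + 1)) ∈ E} s
      = ∫ u, ∫ x in B, ψ u • futureMean μ G (k + 1) E (s + x + u) ∂μ k := by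
    refine integral_congr_ae ?_
    filter_upwards [hae] with u hu
    rw [hu, ← integral_smul]
    simp only [add_right_comm]
  rw [e, integral_integral_swap]
  · rfl
  · refine Integrable.smul_bdd (𝕜 := ℝ) (C := M) (hψ.comp_fst _) ?_ ?_
    · exact ((hG.measurable_futureMean (k + 1) E).comp (by fun_prop)).aestronglyMeasurable
    · exact Filter.Eventually.of_forall fun p => hG.norm_futureMean_le _ _ _

/-- Smoothing functions with a common bound gives functions with a common `SmoothBound`; the derivatives
of the convolution fall on the weight. -/
theorem exists_smoothBound_integral_smul {ψ : ℝ → ℝ} (hψ : ContDiff ℝ (⊤ : ℕ∞) ψ)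
    (hψc : HasCompactSupport ψ) (M : ℝ) :
    ∃ M' > 0, ∀ f : ℝ → ℂ, Measurable f → (∀ t, ‖f t‖ ≤ M) →
      SmoothBound M' fun s => ∫ u, ψ u • f (s + u) := by
  set φ : ℝ → ℝ := fun x => ψ (-x) with hφ
  have hφs : ContDiff ℝ (⊤ : ℕ∞) φ := hψ.comp contDiff_neg
  have hφc : HasCompactSupport φ := hψc.comp_homeomorph (Homeomorph.neg ℝ)
  have hφ1 : ContDiff ℝ (⊤ : ℕ∞) (deriv φ) := hφs.iterate_deriv 1
  have hφ2 : ContDiff ℝ (⊤ : ℕ∞) (deriv (deriv φ)) := hφs.iterate_deriv 2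
  set L : ℂ →L[ℝ] ℝ →L[ℝ] ℂ := (ContinuousLinearMap.lsmul ℝ ℝ).flip
  set c : ℝ := (∫ x, ‖φ x‖) + (∫ x, ‖deriv φ x‖) + ∫ x, ‖deriv (deriv φ) x‖ with hc
  have i0 := (hφs.continuous.integrable_of_hasCompactSupport hφc (μ := volume)).norm
  have i1 := (hφ1.continuous.integrable_of_hasCompactSupport hφc.deriv (μ := volume)).norm
  have i2 := (hφ2.continuous.integrable_of_hasCompactSupport hφc.deriv.deriv (μ := volume)).norm
  have n0 : 0 ≤ ∫ x, ‖φ x‖ := integral_nonneg fun _ => norm_nonneg _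
  have n1 : 0 ≤ ∫ x, ‖deriv φ x‖ := integral_nonneg fun _ => norm_nonneg _
  have n2 : 0 ≤ ∫ x, ‖deriv (deriv φ) x‖ := integral_nonneg fun _ => norm_nonneg _
  have hc0 : 0 ≤ c := by linarith
  refine ⟨|M| * c + 1, by positivity, fun f hf hfM => ?_⟩
  have hloc : LocallyIntegrable f := (memLp_top_of_bound hf.aestronglyMeasurable M
    (Filter.Eventually.of_forall hfM)).locallyIntegrable le_top
  have e : (fun s => ∫ u, ψ u • f (s + u)) = convolution f φ L volume := by
    funext s
    rw [convolution_def, ← integral_add_left_eq_self (fun t => L (f t) (φ (s - t))) s]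
    refine integral_congr_ae (Filter.Eventually.of_forall fun u => ?_)
    simp [L, hφ]
  have bound : ∀ χ : ℝ → ℝ, Integrable (fun x => ‖χ x‖) → (∫ x, ‖χ x‖ ≤ c) →
      ∀ x, ‖convolution f χ L volume x‖ ≤ |M| * c + 1 := by
    intro χ hχ hχc x
    have h1 : ‖convolution f χ L volume x‖ ≤ ∫ t, |M| * ‖χ (x - t)‖ := by
      refine norm_integral_le_of_norm_le ((hχ.comp_sub_left x).const_mul _)
        (Filter.Eventually.of_forall fun t => ?_)
      simp only [L, ContinuousLinearMap.flip_apply, ContinuousLinearMap.lsmul_apply, norm_smul]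
      rw [mul_comm]
      gcongr
      exact (hfM t).trans (le_abs_self M)
    rw [integral_const_mul, integral_sub_left_eq_self (fun t => ‖χ t‖) volume x] at h1
    nlinarith [abs_nonneg M]
  have hd : ∀ x, HasDerivAt (convolution f φ L volume) (convolution f (deriv φ) L volume x) x :=
    hφc.hasDerivAt_convolution_right L hloc (hφs.of_le (by simp))
  have hd2 : ∀ x, HasDerivAt (convolution f (deriv φ) L volume)
      (convolution f (deriv (deriv φ)) L volume x) x :=
    hφc.deriv.hasDerivAt_convolution_right L hloc (hφ1.of_le (by simp))
  have hde : deriv (convolution f φ L volume) = convolution f (deriv φ) L volume :=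
    funext fun x => (hd x).deriv
  rw [e]
  refine ⟨fun x => (hd x).differentiableAt, bound φ i0 (by linarith), ?_, ?_⟩
  · rw [hde]
    exact bound _ i1 (by linarith)
  · rw [hde]
    intro s t
    exact convex_univ.norm_image_sub_le_of_norm_hasDerivWithin_le
      (fun x _ => (hd2 x).hasDerivWithinAt) (fun x _ => bound _ i2 (by linarith) x)
      (Set.mem_univ t) (Set.mem_univ s)

/-- The sequences whose first `m` steps lie in prescribed sets. -/
def stepBox : ℕ → (ℕ → Set ℝ) → Set (ℕ → ℝ)
  | 0, _ => Set.univ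
  | m + 1, B => {ω | ω 0 ∈ B 0 ∧ (fun n => ω (n + 1)) ∈ stepBox m fun n => B (n + 1)}

theorem mem_stepBox {m : ℕ} {B : ℕ → Set ℝ} {ω : ℕ → ℝ} :
    ω ∈ stepBox m B ↔ ∀ i < m, ω i ∈ B i := by
  induction m generalizing B ω with
  | zero => simp [stepBox]
  | succ m ih =>
    simp only [stepBox, Set.mem_ofPred_eq, ih]
    constructor
    · rintro ⟨h0, h1⟩ i hi
      cases i with
      | zero => exact h0
      | succ i => exact h1 i (by omega)
    · exact fun h => ⟨h 0 (by omega), fun i hi => h (i + 1) (by omega)⟩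

theorem measurableSet_stepBox {m : ℕ} {B : ℕ → Set ℝ} (hB : ∀ i, MeasurableSet (B i)) :
    MeasurableSet (stepBox m B) := by
  induction m generalizing B with
  | zero => exact MeasurableSet.univ
  | succ m ih =>
    exact (measurable_pi_apply 0 (hB 0)).inter
      ((by fun_prop : Measurable fun (ω : ℕ → ℝ) n => ω (n + 1)) (ih fun i => hB (i + 1)))

/-- A common period of the smooth harmonic families is a period of all smoothed means over boxes: the
mean over all future steps is harmonic, and a restriction on the first step is removed by
conditioning on it. -/
theorem CompatibleFamily.smoothMean_stepBox_add (hG : CompatibleFamily μ M G) {τ : ℝ}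
    (hτ : ∀ (M : ℝ) (H : ℕ → ℝ → ℂ), 0 < M → (∀ k, SmoothBound M (H k)) →
      (∀ k t, H k t = ∫ x, H (k + 1) (t + x) ∂μ k) → ∀ k t, H k (t + τ) = H k t)
    {ψ : ℝ → ℝ} (hψ : ContDiff ℝ (⊤ : ℕ∞) ψ) (hψc : HasCompactSupport ψ) (m : ℕ) :
    ∀ (k : ℕ) (B : ℕ → Set ℝ), (∀ i, MeasurableSet (B i)) → ∀ s,
      smoothMean μ G ψ k (stepBox m B) (s + τ) = smoothMean μ G ψ k (stepBox m B) s := by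
  have hψi : Integrable ψ := hψ.continuous.integrable_of_hasCompactSupport hψc
  induction m with
  | zero =>
    intro k B _ s
    obtain ⟨M', hM', hs⟩ := exists_smoothBound_integral_smul hψ hψc M
    refine hτ M' (fun k => smoothMean μ G ψ k Set.univ) hM' (fun k => hs _
      (hG.measurable_futureMean k _) (hG.norm_futureMean_le k _)) (fun k t => ?_) k s
    have := hG.smoothMean_eq hψi k MeasurableSet.univ MeasurableSet.univ t
    simpa using this
  | succ m ih =>
    intro k B hB s
    have hE : MeasurableSet (stepBox m fun n => B (n + 1)) :=
      measurableSet_stepBox fun i => hB (i + 1)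
    rw [stepBox, hG.smoothMean_eq hψi k (hB 0) hE, hG.smoothMean_eq hψi k (hB 0) hE]
    refine integral_congr_ae (Filter.Eventually.of_forall fun x => ?_)
    dsimp only
    rw [add_right_comm, ih (k + 1) _ (fun i => hB (i + 1))]

end

/-! ### Periodicity of the tail boundary -/

/-- A bounded function on a product is null if its means over the sets of a generating π-system in
the second variable vanish, for almost every value of the first variable. -/
theorem ae_eq_zero_of_integral_piSystem {X Y : Type*} [MeasurableSpace X] [MeasurableSpace Y]
    {P : Measure X} {Q : Measure Y} [IsFiniteMeasure P] [IsFiniteMeasure Q] {D : X × Y → ℂ}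
    (hD : Measurable D) {M : ℝ} (hM : ∀ p, ‖D p‖ ≤ M) {S : Set (Set Y)}
    (hS : MeasurableSpace.generateFrom S = ‹MeasurableSpace Y›) (hpi : IsPiSystem S)
    (huniv : Set.univ ∈ S)
    (h0 : ∀ E ∈ S, ∀ᵐ x ∂P, ∫ y in E, D (x, y) ∂Q = 0) :
    D =ᵐ[P.prod Q] 0 := by
  have hi : Integrable D (P.prod Q) := Integrable.of_bound hD.aestronglyMeasurable M
    (Filter.Eventually.of_forall hM)
  have hiQ : ∀ x, Integrable (fun y => D (x, y)) Q := fun x =>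
    Integrable.of_bound (hD.comp (by fun_prop)).aestronglyMeasurable M
      (Filter.Eventually.of_forall fun y => hM _)
  have hsec : ∀ x (A : Set (X × Y)), MeasurableSet A → MeasurableSet (Prod.mk x ⁻¹' A) :=
    fun x A hA => measurable_prodMk_left hA
  have hgen := generateFrom_eq_prod MeasurableSpace.generateFrom_measurableSet hS
    (isCountablySpanning_measurableSet (α := X))
    ⟨fun _ => Set.univ, fun _ => huniv, Set.iUnion_const _⟩
  have key : ∀ A : Set (X × Y), MeasurableSet A →
      ∀ᵐ x ∂P, ∫ y in Prod.mk x ⁻¹' A, D (x, y) ∂Q = 0 := by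
    refine MeasurableSpace.induction_on_inter hgen.symm
      (MeasurableSpace.isPiSystem_measurableSet.prod hpi) ?_ ?_ ?_ ?_
    · simp
    · rintro _ ⟨B, -, E, hE, rfl⟩
      filter_upwards [h0 E hE] with x hx
      by_cases hxB : x ∈ B
      · simpa [Set.mk_preimage_prod_right hxB] using hx
      · simp [Set.mk_preimage_prod_right_eq_empty hxB]
    · intro A hA h
      filter_upwards [h, h0 _ huniv] with x hx hx2
      rw [Set.preimage_compl, setIntegral_compl (hsec x A hA) (hiQ x), hx]
      simpa using hx2
    · intro A hdisj hA h
      filter_upwards [ae_all_iff.2 h] with x hx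
      rw [Set.preimage_iUnion, integral_iUnion (fun n => hsec x _ (hA n))
        (fun i j hij => (hdisj hij).preimage _) (hiQ x).integrableOn]
      simp [hx]
  refine hi.ae_eq_zero_of_forall_setIntegral_eq_zero fun A hA _ => ?_
  rw [← integral_indicator hA, integral_prod _ (hi.indicator hA)]
  refine integral_eq_zero_of_ae ?_
  filter_upwards [key A hA] with x hx
  rw [Pi.zero_apply, ← hx, ← integral_indicator (hsec x A hA)]
  rfl

section

variable {μ : ℕ → Measure ℝ} [∀ k, IsProbabilityMeasure (μ k)] {M : ℝ}
  {G : ℕ → ℝ × (ℕ → ℝ) → ℂ}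

theorem CompatibleFamily.ae_periodic (hG : CompatibleFamily μ M G) {τ : ℝ}
    (hτ : ∀ (M : ℝ) (H : ℕ → ℝ → ℂ), 0 < M → (∀ k, SmoothBound M (H k)) →
      (∀ k t, H k t = ∫ x, H (k + 1) (t + x) ∂μ k) → ∀ k t, H k (t + τ) = H k t)
    (μ₀ : Measure ℝ) [IsProbabilityMeasure μ₀] (hμ₀ : μ₀ ≪ volume) :
    ∀ᵐ p ∂(pathLaw μ₀ μ 0), G 0 (p.1 + τ, p.2) = G 0 p := by
  have hm0 := hG.measurable 0
  have hi : ∀ t, Integrable (fun ω => G 0 (t, ω)) (stepLaw μ 0) := fun t =>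
    Integrable.of_bound (hm0.comp (by fun_prop)).aestronglyMeasurable M
      (Filter.Eventually.of_forall fun ω => hG.norm_le _ _)
  have main : (fun p : ℝ × (ℕ → ℝ) => G 0 (p.1 + τ, p.2) - G 0 p) =ᵐ[μ₀.prod (stepLaw μ 0)] 0 := by
    refine ae_eq_zero_of_integral_piSystem (M := 2 * M) ((hm0.comp (by fun_prop)).sub hm0)
      (fun p => (norm_sub_le _ _).trans ?_)
      generateFrom_squareCylinders (isPiSystem_squareCylinders
        (fun _ => MeasurableSpace.isPiSystem_measurableSet)
        (fun _ => MeasurableSet.univ (α := ℝ)))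
      ⟨∅, fun _ => Set.univ, fun _ _ => MeasurableSet.univ (α := ℝ), by simp⟩ ?_
    · linarith [hG.norm_le 0 (p.1 + τ, p.2), hG.norm_le 0 p]
    rintro _ ⟨s, B, hB, rfl⟩
    obtain ⟨m, B', hB', e⟩ : ∃ m B', (∀ i, MeasurableSet (B' i)) ∧
        Set.pi (s : Set ℕ) B = stepBox m B' := by
      classical
      refine ⟨s.sup id + 1, fun i => if i ∈ s then B i else Set.univ, fun i => ?_, ?_⟩
      · dsimp only
        split_ifs
        · exact hB i trivial
        · exact MeasurableSet.univ
      · ext ω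
        rw [mem_stepBox, Set.mem_pi]
        constructor
        · intro h i _
          split_ifs with hi
          · exact h i hi
          · trivial
        · intro h i hi
          have := h i (Nat.lt_succ_of_le (Finset.le_sup (f := id) hi))
          rwa [if_pos (by exact hi)] at this
    rw [e]
    set f := futureMean μ G 0 (stepBox m B') with hf
    have hfm : Measurable f := hG.measurable_futureMean 0 _
    have hfM : ∀ t, ‖f t‖ ≤ M := hG.norm_futureMean_le 0 _
    have hsub : ∀ t, ∫ ω in stepBox m B', (G 0 (t + τ, ω) - G 0 (t, ω)) ∂stepLaw μ 0
        = f (t + τ) - f t := fun t =>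
      integral_sub (hi _).integrableOn (hi _).integrableOn
    simp only [hsub]
    refine hμ₀.ae_le (ae_eq_zero_of_integral_contDiff_smul_eq_zero ?_ fun ψ hψ hψc => ?_)
    · exact (memLp_top_of_bound (C := 2 * M)
        ((hfm.comp (by fun_prop)).sub hfm).aestronglyMeasurable
        (Filter.Eventually.of_forall fun t => (norm_sub_le _ _).trans
          (by simpa [two_mul] using add_le_add (hfM (t + τ)) (hfM t)))).locallyIntegrable le_top
    · have hψi : Integrable ψ := hψ.continuous.integrable_of_hasCompactSupport hψc
      have h1 := hG.smoothMean_stepBox_add hτ hψ hψc m 0 B' hB' 0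
      simp only [smoothMean, ← hf, zero_add] at h1
      have hint : ∀ c, Integrable fun u => ψ u • f (u + c) := fun c =>
        hψi.smul_bdd M (hfm.comp (by fun_prop)).aestronglyMeasurable
          (Filter.Eventually.of_forall fun t => hfM _)
      have h0 := hint 0
      simp only [add_zero] at h0
      simp only [smul_sub]
      rw [integral_sub (hint τ) h0, sub_eq_zero, ← h1]
      simp only [add_comm τ]
  filter_upwards [main] with p hp
  exact sub_eq_zero.1 hp

theorem measurePreserving_tailMap (μ : ℕ → Measure ℝ) [∀ k, IsProbabilityMeasure (μ k)] (n : ℕ) :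
    MeasurePreserving (tailMap n) ((volume : Measure ℝ).prod (stepLaw μ 0))
      ((volume : Measure ℝ).prod (stepLaw μ n)) := by
  have h1 : MeasurePreserving
      (fun q : (ℕ → ℝ) × ℝ => ((fun k => q.1 (k + n)), q.2 + ∑ i ∈ Finset.range n, q.1 i))
      ((stepLaw μ 0).prod volume) ((stepLaw μ n).prod volume) :=
    (measurePreserving_steps μ n).skew_product
      (g := fun ω t => t + ∑ i ∈ Finset.range n, ω i) (by fun_prop)
      (Filter.Eventually.of_forall fun ω => map_add_right_eq_self volume _)
  exact Measure.measurePreserving_swap.comp (h1.comp Measure.measurePreserving_swap)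

/-- The functions `G n` with `F = G n ∘ π_n` form a compatible family, because `π_n` preserves the
product of the Lebesgue measure and the law of the steps, so that identities between functions
composed with `π_n` descend. -/
theorem exists_compatibleFamily (μ₀ : Measure ℝ) [IsProbabilityMeasure μ₀] [LebesgueEquivalent μ₀]
    {F : (ℝ × (ℕ → ℝ)) →ₘ[pathLaw μ₀ μ 0] ℂ} (hF : F ∈ tailBoundary μ₀ μ) :
    ∃ M G, CompatibleFamily μ M G ∧ F =ᵐ[pathLaw μ₀ μ 0] G 0 := by
  rw [tailBoundary, StarSubalgebra.mem_iInf] at hF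
  have hF' : ∀ n, ∃ g ∈ Linfty (pathLaw μ₀ μ n),
    pullback (tailMap n) (quasiMeasurePreserving_tailMap μ₀ μ n) g = F := fun n => hF n
  obtain ⟨M, hM0, hM⟩ : ∃ M : ℝ, 0 ≤ M ∧ ∀ᵐ p ∂(pathLaw μ₀ μ 0), ‖F p‖ ≤ M := by
    obtain ⟨g, hg, hgF⟩ := hF' 0
    have hFL : MemLp F ∞ (pathLaw μ₀ μ 0) :=
      hgF ▸ pullback_mem_Linfty _ (quasiMeasurePreserving_tailMap μ₀ μ 0) hg
    have hfin : eLpNormEssSup F (pathLaw μ₀ μ 0) < ∞ := by simpa using hFL.2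
    refine ⟨(eLpNormEssSup F (pathLaw μ₀ μ 0)).toReal, ENNReal.toReal_nonneg, ?_⟩
    filter_upwards [ae_le_eLpNormEssSup (f := F) (μ := pathLaw μ₀ μ 0)] with p hp
    have := ENNReal.toReal_mono hfin.ne hp
    simpa using this
  choose g _ hgF using hF'
  -- Truncation at the essential bound of `F` does not change the composition with `tailMap n`.
  set G : ℕ → ℝ × (ℕ → ℝ) → ℂ := fun n p => if ‖g n p‖ ≤ M then g n p else 0 with hG
  have hgm : ∀ n, Measurable (g n) := fun n => (g n).stronglyMeasurable.measurable
  have hGm : ∀ n, Measurable (G n) := fun n =>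
    Measurable.ite (measurableSet_le (hgm n).norm measurable_const) (hgm n) measurable_const
  have hGF : ∀ n, ∀ᵐ p ∂(pathLaw μ₀ μ 0), F p = G n (tailMap n p) := by
    intro n
    have := pullback_coeFn _ (quasiMeasurePreserving_tailMap μ₀ μ n) (g n)
    rw [hgF] at this
    filter_upwards [this, hM] with p hp hpM
    rw [hp] at hpM
    rw [hp, hG]
    exact (if_pos hpM).symm
  refine ⟨M, G, ⟨hGm, fun k p => ?_, fun k => ?_⟩, ?_⟩
  · simp only [hG]
    split_ifs with h
    · exact h
    · simpa using hM0
  · have hac : (volume : Measure ℝ).prod (stepLaw μ 0) ≪ pathLaw μ₀ μ 0 :=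
      LebesgueEquivalent.volume_ac.prod Measure.AbsolutelyContinuous.rfl
    have hstep : Measurable fun p : ℝ × (ℕ → ℝ) =>
        G (k + 1) (p.1 + p.2 0, fun n => p.2 (n + 1)) := (hGm (k + 1)).comp (by fun_prop)
    rw [← (measurePreserving_tailMap μ k).map_eq, ae_map_iff
      (measurePreserving_tailMap μ k).measurable.aemeasurable
      (measurableSet_eq_fun (hGm k) hstep)]
    filter_upwards [hac.ae_le (hGF k), hac.ae_le (hGF (k + 1))] with p h1 h2
    rw [← h1, h2]
    congr 1
    simp only [tailMap, Finset.sum_range_succ, zero_add, Prod.mk.injEq]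
    refine ⟨by ring, ?_⟩
    funext n
    rw [add_assoc, add_comm 1 k]
  · filter_upwards [hGF 0] with p hp
    rw [hp]
    simp [tailMap]

end

end TailBoundary

theorem mainTheorem9
    (μ₀ : Measure ℝ) [IsProbabilityMeasure μ₀] [TailBoundary.LebesgueEquivalent μ₀]
    (μ : ℕ → Measure ℝ) [∀ n, IsProbabilityMeasure (μ n)]
    (β : ℕ → Measure ℝ) [∀ n, IsFiniteMeasure (β n)]
    (hβμ : ∀ n, β n ≤ μ n)
    (C : ℝ) (hC : 0 < C)
    (hwidth : ∀ n, ∀ᵐ p ∂((β n).prod (β n)), |p.1 - p.2| ≤ C)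
    (hvar : ∑' n, β n Set.univ * evariance id ((β n Set.univ)⁻¹ • β n) = ∞) :
    TailBoundary.IsPeriodicFlow (TailBoundary.tailBoundaryFlow μ₀ μ) := by
  obtain ⟨τ, hτ0, hτ⟩ := TailBoundary.exists_period_of_harmonic hβμ hwidth hvar
  -- The flow translates by `F (t - s, ω)`, whence the sign.
  refine ⟨-τ, neg_ne_zero.2 hτ0, fun F => Subtype.ext ?_⟩
  rw [TailBoundary.coe_tailBoundaryFlow]
  obtain ⟨M, G, hG, hFG⟩ := TailBoundary.exists_compatibleFamily μ₀ F.2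
  have hq := TailBoundary.quasiMeasurePreserving_shift μ₀ μ 0 (- -τ)
  refine AEEqFun.ext ?_
  filter_upwards [TailBoundary.pullback_coeFn _ hq F.1, hq.ae hFG, hFG,
    hG.ae_periodic hτ μ₀ TailBoundary.LebesgueEquivalent.ac] with p h1 h2 h3 h4
  rw [TailBoundary.translate, h1, Function.comp, h2, h3, ← h4, TailBoundary.shift, neg_neg]
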